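/- For a finite simple graph $G$ and a vertex $v$ of $G$, the card $G-v$ is the subgraph of $G$ induced on $V(G)\setminus\{v\}$, taken up to isomorphism; the deck of $G$ is the multiset of the cards $G-v$, $v\in V(G)$. The $K_r$-count of $G$ is the number of $r$-element sets of vertices of $G$ that are pairwise adjacent. Theorem. Let $n\ge 7$ and $r\ge 0$ be integers with $r\le \log_2 n$. Then the $K_r$-count of an $n$-vertex graph can be reconstructed from any $n-1$ of its cards: there is a function $f$ from finite multisets of isomorphism classes of graphs to the non-negative integers such that, for every graph $G$ on $n$ vertices and every sub-multiset $S$ of the deck of $G$ consisting of $n-1$ cards, $f(S)$ equals the $K_r$-count of $G$. -/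

import Mathlib

universe u

/-- Graph isomorphism, as an equivalence relation on all graphs with vertex type in `Type u`. -/
def graphIsoSetoid : Setoid (Σ V : Type u, SimpleGraph V) where
  r A B := Nonempty (A.2 ≃g B.2)
  iseqv :=
    { refl := fun _ => ⟨RelIso.refl _⟩
      symm := fun ⟨e⟩ => ⟨e.symm⟩
      trans := fun ⟨e⟩ ⟨f⟩ => ⟨e.trans f⟩ }

/-- Isomorphism classes of (unlabelled) graphs. -/
def GraphClass : Type (u + 1) := Quotient graphIsoSetoid.{u}

/-- The isomorphism class of a graph. -/
def GraphClass.of {V : Type u} (G : SimpleGraph V) : GraphClass.{u} :=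
  Quotient.mk graphIsoSetoid ⟨V, G⟩

/-- The card `G - v`: the subgraph of `G` induced on all vertices except `v`, up to isomorphism. -/
def graphCard {V : Type u} (G : SimpleGraph V) (v : V) : GraphClass.{u} :=
  GraphClass.of (G.induce ({v}ᶜ : Set V))

/-- The deck of `G`: the multiset of its cards `G - v`, one for every vertex `v`. -/
def deck {V : Type u} [Fintype V] (G : SimpleGraph V) : Multiset GraphClass.{u} :=
  (Finset.univ : Finset V).val.map (graphCard G)

/-- The `K_r`-count of `G`: the number of `r`-element vertex sets that are cliques in `G`. -/
noncomputable def cliqueCount {V : Type u} (G : SimpleGraph V) (r : ℕ) : ℕ :=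
  (G.cliqueSet r).ncard

/-- The graph parameter `p` can be reconstructed from `m` cards for `n`-vertex graphs: its value
at `G` is a function of any multiset consisting of `m` of the `n` cards of `G`. -/
def ReconstructibleFromCards (n m : ℕ) (p : (V : Type u) → SimpleGraph V → ℕ) : Prop :=
  ∃ f : Multiset GraphClass.{u} → ℕ,
    ∀ (V : Type u) [Fintype V] (G : SimpleGraph V), Fintype.card V = n →
      ∀ S : Multiset GraphClass.{u}, S ≤ deck G → Multiset.card S = m → f S = p V G

namespace CliqueReconstruction

open Finset
open scoped Classical

/-! ### Reduction to two graphs on one vertex set -/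

/-! Two n-vertex graphs sharing n-1 cards can be placed on one vertex set so that, for every x other
than one exceptional vertex v, some permutation fixing x restricts to an isomorphism G - x → H - x
(`reconstructible_of_hypomorphicExcept`). Suppose G has a > 0 more r-cliques than H. Comparing
cards, each x ≠ v lies in exactly a more r-cliques of G than of H, and double counting puts v in
(n-1-r)a fewer (`HypomorphicExcept.cliqueDeg_exception`).

For r = 2 this forces a = 1 and deg_G v ≤ 2. Comparing the degree sequences of the cards yields a
recurrence for the numbers of vertices of each degree (`HypomorphicExcept.degCount_recurrence`),
with error terms of total at most 2; for n ≥ 7 it has no admissible solution, apart from two degree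
sequences on 7 vertices that a single well-chosen card excludes.

For the step from q to q+1 ≥ 3, degrees and q-clique degrees already agree. Let A be the set of
vertices of maximum degree. The non-neighbours of x in A are visible in the card at x, being the
vertices whose degree there is still maximum, and so are their clique degrees. Hence for x ≠ v the
clique degrees are distributed alike over these non-neighbours in G and in H (`IsShifted`). Off v
the clique degrees of G are those of H raised by a, and counting the vertices of A level by level
shows that v is in A and that A has one vertex on each level of an arithmetic progression of
difference a. Counting non-adjacent pairs between levels then shows that A is a clique of n-(q+1)
vertices (`IsShifted.isClique`). Their clique degrees differ, so their neighbourhoods among the q+1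
remaining vertices differ, yet these all have one size t. Thus n-(q+1) ≤ C(q+1,t), contradicting
C(q+1,t) + (q+1) < 2^(q+1) ≤ n (`card_le_choose`, `choose_add_lt_two_pow`). -/

theorem exists_equiv_of_map_eq {α β γ : Type*} [Fintype α] [Fintype β] (f : α → γ) (g : β → γ)
    (h : (univ : Finset α).val.map f = (univ : Finset β).val.map g) :
    ∃ e : α ≃ β, ∀ x, g (e x) = f x := by
  have hc : ∀ c, Nonempty ({x // f x = c} ≃ {y // g y = c}) := by
    intro c
    refine ⟨Fintype.equivOfCardEq ?_⟩
    have := congrArg (Multiset.count c) h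
    rw [Multiset.count_map, Multiset.count_map] at this
    rw [Fintype.card_subtype, Fintype.card_subtype]
    simpa [Finset.card_def, Finset.filter_val, eq_comm] using this
  have e := fun c => Classical.choice (hc c)
  refine ⟨(Equiv.sigmaFiberEquiv f).symm.trans
    ((Equiv.sigmaCongrRight e).trans (Equiv.sigmaFiberEquiv g)), fun x => ?_⟩
  exact (e (f x) ⟨x, rfl⟩).2

theorem exists_erase_of_le_map {α γ : Type*} [Fintype α] (f : α → γ)
    (S : Multiset γ) (hS : S ≤ (univ : Finset α).val.map f)
    (hc : Multiset.card S + 1 = Fintype.card α) :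
    ∃ v, S = (univ.erase v).val.map f := by
  obtain ⟨T, hT⟩ := Multiset.le_iff_exists_add.1 hS
  have hT1 : Multiset.card T = 1 := by
    have := congrArg Multiset.card hT
    simp only [Multiset.card_map, Multiset.card_add, card_val, card_univ] at this
    omega
  obtain ⟨c, rfl⟩ := Multiset.card_eq_one.1 hT1
  have hmem : c ∈ (univ : Finset α).val.map f := by rw [hT]; simp
  obtain ⟨v, -, rfl⟩ := Multiset.mem_map.1 hmem
  have h1 : (univ : Finset α).val.map f = f v ::ₘ S := by
    rw [hT, add_comm, Multiset.singleton_add]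
  refine ⟨v, ?_⟩
  have h2 : (univ : Finset α).val.map f = f v ::ₘ (univ.erase v).val.map f := by
    rw [← Multiset.map_cons, ← Finset.insert_val_of_notMem (by simp), insert_erase (mem_univ v)]
  exact (Multiset.cons_inj_right _).1 (h1.symm.trans h2)

/-- `σ` fixes `x` and is an isomorphism from `G - x` onto `H - x`. -/
def IsCardIso {V : Type*} (G H : SimpleGraph V) (x : V) (σ : Equiv.Perm V) : Prop :=
  σ x = x ∧ ∀ y z, y ≠ x → z ≠ x → (G.Adj y z ↔ H.Adj (σ y) (σ z))

/-- All cards of `G` and `H`, except possibly those at `v`, are pairwise isomorphic. -/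
def HypomorphicExcept {V : Type*} (G H : SimpleGraph V) (v : V) : Prop :=
  ∀ x, x ≠ v → ∃ σ, IsCardIso G H x σ

theorem IsCardIso.symm {V : Type*} {G H : SimpleGraph V} {x : V} {σ : Equiv.Perm V}
    (h : IsCardIso G H x σ) : IsCardIso H G x σ.symm := by
  have hx : σ.symm x = x := by rw [Equiv.symm_apply_eq]; exact h.1.symm
  refine ⟨hx, fun y z hy hz => ?_⟩
  have hne : ∀ y, y ≠ x → σ.symm y ≠ x := fun y hy e => hy (by
    rw [Equiv.symm_apply_eq, h.1] at e; exact e)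
  simpa using (h.2 (σ.symm y) (σ.symm z) (hne y hy) (hne z hz)).symm

theorem HypomorphicExcept.symm {V : Type*} {G H : SimpleGraph V} {v : V}
    (h : HypomorphicExcept G H v) : HypomorphicExcept H G v := fun x hx =>
  let ⟨σ, hσ⟩ := h x hx
  ⟨σ.symm, hσ.symm⟩

/-- Extend `ψ` by x ↦ φ x to a bijection V ≃ W and return to V along `φ`. -/
theorem exists_isCardIso_of_iso {V W : Type*} (G : SimpleGraph V) (H : SimpleGraph W)
    (φ : V ≃ W) (x : V)
    (ψ : G.induce ({x}ᶜ : Set V) ≃g H.induce ({φ x}ᶜ : Set W)) :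
    ∃ σ, IsCardIso G (H.comap φ) x σ := by
  let τ : V ≃ W := (Equiv.sumCompl (· ∈ ({x}ᶜ : Set V))).symm.trans
    ((Equiv.sumCongr ψ.toEquiv (((Equiv.setCongr (compl_compl _)).trans
      (Equiv.ofUnique _ _)).trans (Equiv.setCongr (compl_compl {φ x})).symm)).trans
        (Equiv.sumCompl (· ∈ ({φ x}ᶜ : Set W))))
  have hτ : ∀ y (hy : y ≠ x), τ y = ψ ⟨y, hy⟩ := fun y hy => by
    have : (Equiv.sumCompl (· ∈ ({x}ᶜ : Set V))).symm y = Sum.inl ⟨y, hy⟩ :=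
      Equiv.sumCompl_symm_apply_of_pos (p := (· ∈ ({x}ᶜ : Set V))) hy
    simp [τ, this]
    rfl
  have hτx : τ x = φ x := by
    by_contra hne
    have h1 := hτ (τ.symm (ψ (ψ.symm ⟨τ x, hne⟩)))
    have h2 := hτ (ψ.symm ⟨τ x, hne⟩) (ψ.symm ⟨τ x, hne⟩).2
    rw [Subtype.coe_eta, RelIso.apply_symm_apply] at h2
    exact (ψ.symm ⟨τ x, hne⟩).2 (τ.injective h2)
  refine ⟨τ.trans φ.symm, by simp [hτx], fun y z hy hz => ?_⟩
  simp only [SimpleGraph.comap_adj, Equiv.trans_apply, Equiv.apply_symm_apply]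
  rw [hτ y hy, hτ z hz]
  exact (ψ.map_rel_iff (a := ⟨y, hy⟩) (b := ⟨z, hz⟩)).symm

theorem cliqueCount_comap {V W : Type u} (H : SimpleGraph W) (φ : V ≃ W) (r : ℕ) :
    cliqueCount (H.comap φ) r = cliqueCount H r := by
  refine Set.ncard_congr (fun s _ => s.map φ.toEmbedding) ?_ ?_ ?_
  · intro s hs
    simp only [SimpleGraph.mem_cliqueSet_iff, SimpleGraph.isNClique_iff] at hs ⊢
    refine ⟨?_, by simpa using hs.2⟩
    intro a ha b hb hab
    simp only [coe_map, Set.mem_image, mem_coe] at ha hb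
    obtain ⟨a, ha, rfl⟩ := ha
    obtain ⟨b, hb, rfl⟩ := hb
    exact hs.1 ha hb (fun h => hab (by rw [h]))
  · intro s t _ _ h
    exact Finset.map_injective _ h
  · intro t ht
    simp only [SimpleGraph.mem_cliqueSet_iff, SimpleGraph.isNClique_iff] at ht
    refine ⟨t.map φ.symm.toEmbedding, ?_, by ext; simp⟩
    simp only [SimpleGraph.mem_cliqueSet_iff, SimpleGraph.isNClique_iff]
    refine ⟨?_, by simpa using ht.2⟩
    intro a ha b hb hab
    simp only [coe_map, Set.mem_image, mem_coe] at ha hb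
    obtain ⟨a, ha, rfl⟩ := ha
    obtain ⟨b, hb, rfl⟩ := hb
    simpa using ht.1 ha hb (fun h => hab (by rw [h]))

theorem reconstructible_of_hypomorphicExcept (n r : ℕ) (hn : 0 < n)
    (h : ∀ (V : Type u) [Fintype V] (G H : SimpleGraph V) (v : V), Fintype.card V = n →
      HypomorphicExcept G H v → cliqueCount G r = cliqueCount H r) :
    ReconstructibleFromCards.{u} n (n - 1) (fun _ G => cliqueCount G r) := by
  have key : ∀ (V W : Type u) [Fintype V] [Fintype W] (G : SimpleGraph V) (H : SimpleGraph W),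
      Fintype.card V = n → Fintype.card W = n → ∀ S : Multiset GraphClass.{u}, S ≤ deck G →
      S ≤ deck H → Multiset.card S = n - 1 → cliqueCount G r = cliqueCount H r := by
    intro V W _ _ G H hV hW S hG hH hS
    obtain ⟨v, hv⟩ := exists_erase_of_le_map (graphCard G) S hG (by omega)
    obtain ⟨w, hw⟩ := exists_erase_of_le_map (graphCard H) S hH (by omega)
    -- Marking the missing card by `none` makes the two full families equal as multisets, so that
    -- one bijection matches the cards and also sends v to w.
    have hext : ∀ (X : Type u) [Fintype X] (F : SimpleGraph X) (x : X),
        (univ : Finset X).val.map (fun y => if y = x then none else some (graphCard F y)) =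
          none ::ₘ ((univ.erase x).val.map (graphCard F)).map some := by
      intro X _ F x
      rw [← insert_erase (mem_univ x), Finset.insert_val_of_notMem (by simp),
        Multiset.map_cons, if_pos rfl, Multiset.map_map]
      congr 1
      rw [insert_erase (mem_univ x)]
      refine Multiset.map_congr rfl fun y hy => ?_
      rw [if_neg (Finset.mem_erase.1 (Finset.mem_def.2 hy)).1]
      rfl
    obtain ⟨φ, hφ⟩ := exists_equiv_of_map_eq _ _
      ((hext V G v).trans (by rw [← hv, hw, ← hext W H w]))
    have hφv : φ v = w := by
      have := hφ v
      by_contra hne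
      simp [hne] at this
    rw [← cliqueCount_comap H φ r]
    refine h V G _ v hV fun x hx => ?_
    have h1 := hφ x
    have h2 : φ x ≠ w := fun e => hx (φ.injective (e.trans hφv.symm))
    rw [if_neg h2, if_neg hx, Option.some_inj] at h1
    obtain ⟨ψ⟩ := Quotient.exact h1.symm
    exact exists_isCardIso_of_iso G H φ x ψ
  -- The reconstruction function evaluates any graph whose deck contains S; `key` makes the choice
  -- irrelevant. The value 0 is only a default for unrealisable S.
  let P : Multiset GraphClass.{u} → (Σ V : Type u, SimpleGraph V) → Prop := fun S X =>
    ∃ _ : Fintype X.1, Fintype.card X.1 = n ∧ S ≤ deck X.2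
  refine ⟨fun S => if hS : ∃ X, P S X then cliqueCount hS.choose.2 r else 0, ?_⟩
  intro V _ G hV S hS hc
  have hex : ∃ X, P S X := ⟨⟨V, G⟩, inferInstance, hV, hS⟩
  obtain ⟨i, h1, h2⟩ := hex.choose_spec
  simp only [dif_pos hex]
  exact key _ _ _ _ h1 hV S h2 hS hc

/-! ### Cliques through a vertex -/

section Counting

theorem isNClique_map_iff {V : Type*} {G H : SimpleGraph V} (σ : Equiv.Perm V) (r : ℕ) (s : Finset V)
    (h : ∀ y ∈ s, ∀ z ∈ s, (G.Adj y z ↔ H.Adj (σ y) (σ z))) :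
    G.IsNClique r s ↔ H.IsNClique r (s.map σ.toEmbedding) := by
  simp only [SimpleGraph.isNClique_iff, card_map]
  refine and_congr_left fun _ => ⟨fun hs => ?_, fun hs => ?_⟩
  · intro a ha b hb hab
    simp only [coe_map, Set.mem_image, mem_coe] at ha hb
    obtain ⟨a, ha, rfl⟩ := ha
    obtain ⟨b, hb, rfl⟩ := hb
    exact (h a ha b hb).1 (hs ha hb (fun h => hab (by rw [h])))
  · intro a ha b hb hab
    refine (h a ha b hb).2 (hs ?_ ?_ (fun e => hab (σ.injective e))) <;>
      simpa

variable {V : Type*} [Fintype V]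

/-- The number of `r`-cliques of `G`. -/
noncomputable def numCliques (G : SimpleGraph V) (r : ℕ) : ℕ :=
  #{s : Finset V | G.IsNClique r s}

/-- The number of `r`-cliques of `G` containing `x`. -/
noncomputable def cliqueDeg (G : SimpleGraph V) (r : ℕ) (x : V) : ℕ :=
  #{s : Finset V | G.IsNClique r s ∧ x ∈ s}

/-- The number of neighbours of `x`. -/
noncomputable def vdeg (G : SimpleGraph V) (x : V) : ℕ := #{y | G.Adj x y}

theorem cliqueCount_eq_numCliques {V : Type u} [Fintype V] (G : SimpleGraph V) (r : ℕ) :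
    cliqueCount G r = numCliques G r := by
  rw [cliqueCount, numCliques, ← Set.ncard_coe_finset]
  congr 1
  ext s
  simp [SimpleGraph.mem_cliqueSet_iff]

theorem card_cliques_eq {G H : SimpleGraph V} (σ : Equiv.Perm V) (r : ℕ)
    (P Q : Finset V → Prop) [DecidablePred fun s => G.IsNClique r s ∧ P s]
    [DecidablePred fun s => H.IsNClique r s ∧ Q s] (hPQ : ∀ s, P s ↔ Q (s.map σ.toEmbedding))
    (h : ∀ s, P s → ∀ y ∈ s, ∀ z ∈ s, (G.Adj y z ↔ H.Adj (σ y) (σ z))) :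
    #{s : Finset V | G.IsNClique r s ∧ P s} = #{s : Finset V | H.IsNClique r s ∧ Q s} := by
  refine Finset.card_equiv (Equiv.finsetCongr σ) fun s => ?_
  simp only [mem_filter, mem_univ, true_and, Equiv.finsetCongr_apply, ← hPQ]
  exact and_congr_left fun hP => isNClique_map_iff σ r s (h s hP)

theorem numCliques_eq_of_iso {G H : SimpleGraph V} (σ : Equiv.Perm V) (r : ℕ)
    (h : ∀ y z, G.Adj y z ↔ H.Adj (σ y) (σ z)) : numCliques G r = numCliques H r := by
  have := card_cliques_eq (G := G) (H := H) σ r (fun _ => True) (fun _ => True) (by simp)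
    (fun s _ y _ z _ => h y z)
  simpa [numCliques] using this

theorem cliqueDeg_eq_of_iso {G H : SimpleGraph V} (σ : Equiv.Perm V) (r : ℕ) (x : V)
    (h : ∀ y z, G.Adj y z ↔ H.Adj (σ y) (σ z)) : cliqueDeg G r x = cliqueDeg H r (σ x) :=
  card_cliques_eq (G := G) (H := H) σ r (fun s => x ∈ s) (fun s => σ x ∈ s) (by simp)
    (fun s _ y _ z _ => h y z)

theorem numCliques_eq_add (G : SimpleGraph V) (r : ℕ) (x : V) :
    numCliques G r = cliqueDeg G r x + #{s : Finset V | G.IsNClique r s ∧ x ∉ s} := by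
  rw [numCliques, cliqueDeg, ← filter_filter, ← filter_filter,
    card_filter_add_card_filter_not]

theorem sum_cliqueDeg (G : SimpleGraph V) (r : ℕ) :
    ∑ x, cliqueDeg G r x = r * numCliques G r := by
  have h1 : ∀ x, cliqueDeg G r x =
      ∑ s ∈ ({s : Finset V | G.IsNClique r s} : Finset (Finset V)), if x ∈ s then 1 else 0 := by
    intro x
    rw [cliqueDeg, ← filter_filter, card_filter]
  simp only [h1]
  rw [sum_comm, numCliques, mul_comm, ← smul_eq_mul, ← sum_const]
  refine sum_congr rfl fun s hs => ?_
  rw [sum_boole]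
  simpa using ((mem_filter.1 hs).2).card_eq

/-- Isomorphic cards at `x` contain equally many cliques. -/
theorem IsCardIso.numCliques_add {G H : SimpleGraph V} {x : V} {σ : Equiv.Perm V}
    (h : IsCardIso G H x σ) (r : ℕ) :
    numCliques G r + cliqueDeg H r x = numCliques H r + cliqueDeg G r x := by
  have := card_cliques_eq (G := G) (H := H) σ r (fun s => x ∉ s) (fun s => x ∉ s)
    (fun s => by
      have : σ x ∈ s.map σ.toEmbedding ↔ x ∈ s := by simp
      rw [h.1] at this; rw [this])
    (fun s hs y hy z hz => h.2 y z (fun e => hs (e ▸ hy)) (fun e => hs (e ▸ hz)))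
  have h1 := numCliques_eq_add G r x
  have h2 := numCliques_eq_add H r x
  omega

/-- A clique count at a vertex `u ≠ x`, restricted to the card at `x`, is invariant. -/
theorem IsCardIso.cliqueDeg_eq {G H : SimpleGraph V} {x u : V} {σ : Equiv.Perm V}
    (h : IsCardIso G H x σ) (r : ℕ) (hux : u ≠ x) (hG : ¬ G.Adj x u) (hH : ¬ H.Adj x (σ u)) :
    cliqueDeg G r u = cliqueDeg H r (σ u) := by
  have := card_cliques_eq (G := G) (H := H) σ r (fun s => u ∈ s ∧ x ∉ s)
    (fun s => σ u ∈ s ∧ x ∉ s)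
    (fun s => by
      have : σ x ∈ s.map σ.toEmbedding ↔ x ∈ s := by simp
      rw [h.1] at this; rw [this]; simp)
    (fun s hs y hy z hz => h.2 y z (fun e => hs.2 (e ▸ hy)) (fun e => hs.2 (e ▸ hz)))
  have aux : ∀ (F : SimpleGraph V) (w : V), w ≠ x → ¬ F.Adj x w →
      cliqueDeg F r w = #{s : Finset V | F.IsNClique r s ∧ w ∈ s ∧ x ∉ s} := by
    intro F w hw hF
    rw [cliqueDeg]
    congr 1
    ext s
    simp only [mem_filter, mem_univ, true_and]
    refine and_congr_right fun hs => ⟨fun h => ⟨h, fun hx => ?_⟩, fun h => h.1⟩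
    exact hF (hs.isClique hx h hw.symm)
  have hσ : σ u ≠ x := fun e => hux (σ.injective (e.trans h.1.symm))
  rw [aux G u hux hG, aux H _ hσ hH, this]

/-- Degrees inside the card at `x` are preserved. -/
theorem IsCardIso.vdeg_eq {G H : SimpleGraph V} {x u : V} {σ : Equiv.Perm V}
    (h : IsCardIso G H x σ) (hux : u ≠ x) :
    (vdeg G u : ℤ) - (if G.Adj x u then 1 else 0) =
      vdeg H (σ u) - (if H.Adj x (σ u) then 1 else 0) := by
  have aux : ∀ (F : SimpleGraph V) (w : V),
      (vdeg F w : ℤ) - (if F.Adj x w then 1 else 0) =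
        #{y | y ≠ x ∧ F.Adj w y} := by
    intro F w
    rw [vdeg, ← card_filter_add_card_filter_not (p := fun y => y = x), filter_filter,
      filter_filter]
    have : #{y | F.Adj w y ∧ y = x} = if F.Adj x w then 1 else 0 := by
      split_ifs with hF
      · rw [card_eq_one]
        refine ⟨x, ?_⟩
        ext y
        simp only [mem_filter, mem_univ, true_and, mem_singleton]
        exact ⟨fun h => h.2, fun h => ⟨h ▸ hF.symm, h⟩⟩
      · rw [card_eq_zero, filter_eq_empty_iff]
        rintro y - ⟨h1, rfl⟩
        exact hF h1.symm
    rw [this]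
    push_cast
    rw [add_sub_cancel_left]
    congr 2
    ext y
    simp [and_comm]
  rw [aux, aux]
  congr 1
  refine Finset.card_equiv σ fun y => ?_
  simp only [mem_filter, mem_univ, true_and]
  have : σ y = x ↔ y = x := ⟨fun e => σ.injective (e.trans h.1.symm), fun e => e ▸ e ▸ h.1⟩
  rw [ne_eq, ne_eq, this]
  exact and_congr_right fun hy => h.2 u y hux hy

variable {G H : SimpleGraph V} {v : V}

theorem HypomorphicExcept.cliqueDeg_eq_add (h : HypomorphicExcept G H v) (r : ℕ) {x : V}
    (hx : x ≠ v) :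
    (cliqueDeg G r x : ℤ) = cliqueDeg H r x + ((numCliques G r : ℤ) - numCliques H r) := by
  obtain ⟨σ, hσ⟩ := h x hx
  have := hσ.numCliques_add r
  omega

/-- Clique degrees sum to r times the number of cliques; the n-1 other vertices contribute (n-1)a to
a difference of ra, and v must absorb the rest. -/
theorem HypomorphicExcept.cliqueDeg_exception (h : HypomorphicExcept G H v) (r : ℕ) :
    (cliqueDeg H r v : ℤ) = cliqueDeg G r v +
      ((Fintype.card V : ℤ) - 1 - r) * ((numCliques G r : ℤ) - numCliques H r) := by
  have h1 : ∑ x ∈ univ.erase v, (cliqueDeg G r x : ℤ) = ∑ x ∈ univ.erase v,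
      ((cliqueDeg H r x : ℤ) + ((numCliques G r : ℤ) - numCliques H r)) :=
    sum_congr rfl fun x hx => h.cliqueDeg_eq_add r (ne_of_mem_erase hx)
  rw [sum_add_distrib, sum_const, card_erase_of_mem (mem_univ v), card_univ] at h1
  have hG := sum_cliqueDeg G r
  have hH := sum_cliqueDeg H r
  rw [← add_sum_erase _ _ (mem_univ v)] at hG hH
  zify at hG hH
  have hpos : 1 ≤ Fintype.card V := Fintype.card_pos_iff.2 ⟨v⟩
  rw [nsmul_eq_mul, Nat.cast_sub hpos] at h1
  push_cast at h1
  linear_combination hH - hG + h1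

end Counting

/-! ### The number of edges -/

section Edges

/-- Here N = n-2, `l k` counts the vertices other than v of degree k in G, `s k` is the mixed count,
and `e k` is `degCount_recurrence` at k when deg_G v = 0 and deg_H v = n-3. The indicator of deg_H v
reaches these small k only for N = 5 or 6. -/
theorem isolated_exception_arith (N l0 l1 l2 l3 l4 l5 l6 s0 s1 s2 s3 s4 s5 : ℤ) (hN : 5 ≤ N)
    (hl0 : l0 = 0) (hl1 : 0 ≤ l1) (hl2 : 0 ≤ l2) (hl3 : 0 ≤ l3) (hl4 : 0 ≤ l4)
    (_hl6 : 0 ≤ l6) (hs0 : 0 ≤ s0) (hs1 : 0 ≤ s1) (hs2 : 0 ≤ s2)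
    (hs3 : 0 ≤ s3) (hs4 : 0 ≤ s4) (hs5 : 0 ≤ s5) (hs : s0 + s1 + s2 + s3 + s4 + s5 ≤ 2)
    (e0 : N * (l0 - l1) = -(N + 1) - s0 + s1)
    (e1 : (N - 1) * (l1 - l2) + (l2 - l3) = -s1 + s2)
    (e2 : (N - 2) * (l2 - l3) + 2 * (l3 - l4) = -s2 + s3)
    (e3 : N = 5 → (N - 3) * (l3 - l4) + 3 * (l4 - l5) = 4 - s3 + s4)
    (e3' : N = 6 → (N - 3) * (l3 - l4) + 3 * (l4 - l5) = - s3 + s4)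
    (e4 : N = 6 → (N - 4) * (l4 - l5) + 4 * (l5 - l6) = 5 - s4 + s5) : False := by
  subst hl0
  have h1 : l1 = 1 := by
    have : l1 < 2 := by nlinarith
    have : 0 < l1 := by nlinarith
    omega
  subst h1
  have hs1' : s1 = 1 := by omega
  have hs0' : s0 = 0 := by omega
  subst hs1' hs0'
  have h2 : l2 < 2 := by nlinarith
  rcases (by omega : l2 = 0 ∨ l2 = 1) with rfl | rfl
  · have : 4 ≤ l3 := by linarith
    nlinarith
  · have h3 : l3 = 2 - s2 := by linarith
    rcases (by omega : s2 = 0 ∨ s2 = 1) with rfl | rfl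
    · obtain rfl : l3 = 2 := by omega
      have : N < 7 := by linarith
      rcases (by omega : N = 5 ∨ N = 6) with rfl | rfl
      · have := e3 rfl
        omega
      · have := e3' rfl
        have := e4 rfl
        omega
    · obtain rfl : l3 = 1 := by omega
      omega

/-- Same notation, now with deg_G v = 1 and deg_H v = n-2. The recurrence alone does not suffice:
two degree sequences on 7 vertices survive. -/
theorem pendant_exception_arith (N : ℤ) (l s : ℕ → ℤ) (hN : 5 ≤ N)
    (hl0 : l 0 = 0) (hl : ∀ k, 0 ≤ l k) (hs : ∀ k, 0 ≤ s k)
    (hsum : s 0 + s 1 + s 2 + s 3 + s 4 + s 5 + s 6 ≤ 2)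
    (e0 : N * (l 0 - l 1) = -1 - s 0 + s 1)
    (e1 : (N - 1) * (l 1 - l 2) + (l 2 - l 3) = -N - s 1 + s 2)
    (e2 : (N - 2) * (l 2 - l 3) + 2 * (l 3 - l 4) = -s 2 + s 3)
    (e3 : (N - 3) * (l 3 - l 4) + 3 * (l 4 - l 5) = -s 3 + s 4)
    (e4 : N = 5 → (N - 4) * (l 4 - l 5) + 4 * (l 5 - l 6) = 5 - s 4 + s 5)
    (e5 : N = 5 → 5 * (l 6 - l 7) = 1 - s 5 + s 6) (hl7 : N = 5 → l 7 = 0) :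
    N = 5 ∧ s 1 = 1 ∧ s 5 = 1 ∧ l 1 = 0 ∧ l 6 = 0 ∧
      ((l 2 = 1 ∧ l 3 = 3 ∧ l 4 = 0 ∧ l 5 = 2) ∨ (l 2 = 2 ∧ l 3 = 0 ∧ l 4 = 3 ∧ l 5 = 1)) := by
  have hl1 := hl 1
  have hl2 := hl 2
  have hl3 := hl 3
  have hl4 := hl 4
  have hl5 := hl 5
  have hl6 := hl 6
  have hs0 := hs 0
  have hs1 := hs 1
  have hs2 := hs 2
  have hs3 := hs 3
  have hs4 := hs 4
  have hs5 := hs 5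
  have hs6 := hs 6
  generalize l 0 = l0, l 1 = l1, l 2 = l2, l 3 = l3, l 4 = l4, l 5 = l5, l 6 = l6, l 7 = l7,
    s 0 = s0, s 1 = s1, s 2 = s2, s 3 = s3, s 4 = s4, s 5 = s5, s 6 = s6 at *
  subst hl0
  obtain rfl : l1 = 0 := by
    have : l1 < 1 := by nlinarith
    omega
  obtain rfl : s1 = 1 := by omega
  obtain rfl : s0 = 0 := by omega
  have h2 : l2 < 3 := by nlinarith
  rcases (by omega : l2 = 0 ∨ l2 = 1 ∨ l2 = 2) with rfl | rfl | rfl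
  · have : 5 ≤ l3 := by linarith
    nlinarith
  · have h3 : l3 = 3 - s2 := by linarith
    rcases (by omega : s2 = 0 ∨ s2 = 1) with rfl | rfl
    · obtain rfl : l3 = 3 := by omega
      obtain rfl : N = 5 := by omega
      have := e4 rfl
      have := e5 rfl
      have := hl7 rfl
      omega
    · obtain rfl : l3 = 2 := by omega
      have : N ≤ 7 := by omega
      rcases (by omega : N = 5 ∨ N = 6 ∨ N = 7) with rfl | rfl | rfl <;> omega
  · obtain rfl : N = 5 := by omega
    have := e4 rfl
    have := e5 rfl
    have := hl7 rfl
    omega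

variable {V : Type*} [Fintype V]

/-- A clique through `x` is a clique in the neighbourhood of `x` together with `x`. -/
theorem cliqueDeg_succ (G : SimpleGraph V) (r : ℕ) (x : V) :
    cliqueDeg G (r + 1) x = #{s : Finset V | G.IsNClique r s ∧ ∀ y ∈ s, G.Adj x y} := by
  symm
  rw [cliqueDeg]
  refine card_bij (fun s _ => insert x s) ?_ ?_ ?_
  · intro s hs
    simp only [mem_filter, mem_univ, true_and] at hs ⊢
    exact ⟨hs.1.insert hs.2, mem_insert_self _ _⟩
  · intro s hs t ht hst
    simp only [mem_filter, mem_univ, true_and] at hs ht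
    have h1 : x ∉ s := fun h => G.loopless.irrefl _ (hs.2 x h)
    have h2 : x ∉ t := fun h => G.loopless.irrefl _ (ht.2 x h)
    rw [← erase_insert h1, ← erase_insert h2, hst]
  · intro t ht
    simp only [mem_filter, mem_univ, true_and] at ht
    refine ⟨t.erase x, ?_, insert_erase ht.2⟩
    simp only [mem_filter, mem_univ, true_and]
    refine ⟨⟨ht.1.isClique.subset (erase_subset _ _), ?_⟩, fun y hy => ?_⟩
    · rw [card_erase_of_mem ht.2, ht.1.card_eq]; rfl
    · exact ht.1.isClique ht.2 (mem_of_mem_erase hy) (ne_of_mem_erase hy).symm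

theorem cliqueDeg_two (G : SimpleGraph V) (x : V) : cliqueDeg G 2 x = vdeg G x := by
  rw [cliqueDeg_succ, vdeg]
  symm
  refine card_bij (fun y _ => {y}) ?_ ?_ ?_
  · intro y hy
    simpa [SimpleGraph.isNClique_iff] using hy
  · intro y _ z _ h
    exact singleton_injective h
  · intro s hs
    simp only [mem_filter, mem_univ, true_and] at hs
    obtain ⟨y, rfl⟩ := card_eq_one.1 hs.1.card_eq
    exact ⟨y, by simpa using hs.2, rfl⟩

theorem vdeg_lt (G : SimpleGraph V) (x : V) : vdeg G x < Fintype.card V := by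
  rw [vdeg, ← card_univ]
  exact card_lt_card (ssubset_univ_iff.2 fun h => by
    have := mem_univ x
    rw [← h] at this
    simp at this)

/-- The number of vertices of degree `k`. -/
noncomputable def degCount (G : SimpleGraph V) (k : ℕ) : ℕ := #{y | vdeg G y = k}

/-- The number of neighbours of `x` of degree `k`. -/
noncomputable def nbrDegCount (G : SimpleGraph V) (x : V) (k : ℕ) : ℕ :=
  #{y | G.Adj x y ∧ vdeg G y = k}

/-- The number of vertices of degree `k` in the card at `x`. -/
noncomputable def cardDegCount (G : SimpleGraph V) (x : V) (k : ℕ) : ℤ :=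
  degCount G k - (if vdeg G x = k then 1 else 0) - nbrDegCount G x k + nbrDegCount G x (k + 1)

theorem cardDegCount_eq (G : SimpleGraph V) (x : V) (k : ℕ) :
    cardDegCount G x k =
      #{y | y ≠ x ∧ (vdeg G y : ℤ) - (if G.Adj x y then 1 else 0) = k} := by
  have h1 : (if vdeg G x = k then 1 else 0 : ℤ) = ∑ y, if y = x ∧ vdeg G y = k then 1 else 0 := by
    rw [sum_eq_single x]
    · simp
    · intro y _ hy; simp [hy]
    · simp
  rw [cardDegCount, h1, degCount, nbrDegCount, nbrDegCount]
  simp only [card_filter]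
  push_cast
  rw [← sum_sub_distrib, ← sum_sub_distrib, ← sum_add_distrib]
  refine sum_congr rfl fun y _ => ?_
  by_cases hy : y = x
  · subst hy
    simp
  · by_cases ha : G.Adj x y
    · simp only [hy, ha, ne_eq, not_false_eq_true, true_and, false_and, if_true, if_false]
      have : ((vdeg G y : ℤ) - 1 = k) ↔ vdeg G y = k + 1 := by omega
      simp only [this]
      ring
    · simp [hy, ha]

theorem IsCardIso.cardDegCount_eq {G H : SimpleGraph V} {x : V} {σ : Equiv.Perm V}
    (h : IsCardIso G H x σ) (k : ℕ) : cardDegCount G x k = cardDegCount H x k := by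
  rw [CliqueReconstruction.cardDegCount_eq, CliqueReconstruction.cardDegCount_eq]
  congr 1
  refine Finset.card_equiv σ fun y => ?_
  simp only [mem_filter, mem_univ, true_and]
  have : σ y = x ↔ y = x := ⟨fun e => σ.injective (e.trans h.1.symm), fun e => e ▸ e ▸ h.1⟩
  rw [ne_eq, ne_eq, this]
  exact and_congr_right fun hy => by rw [h.vdeg_eq hy]

theorem sum_nbrDegCount (G : SimpleGraph V) (k : ℕ) :
    ∑ x, nbrDegCount G x k = k * degCount G k := by
  simp only [nbrDegCount, card_filter]
  rw [sum_comm, degCount, mul_comm, ← smul_eq_mul, ← sum_const, sum_filter]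
  refine sum_congr rfl fun y _ => ?_
  by_cases hy : vdeg G y = k
  · simp only [hy, and_true, if_true]
    rw [← card_filter, ← hy, vdeg]
    simp only [G.adj_comm]
  · simp [hy]

/-- A vertex of degree k keeps its degree in n-1-k cards; one of degree k+1 drops to k in k+1 cards.
-/
theorem sum_cardDegCount (G : SimpleGraph V) (k : ℕ) :
    ∑ x, cardDegCount G x k = ((Fintype.card V : ℤ) - 1 - k) * degCount G k +
      (k + 1) * degCount G (k + 1) := by
  have h1 := sum_nbrDegCount G k
  have h2 := sum_nbrDegCount G (k + 1)
  zify at h1 h2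
  simp only [cardDegCount, sum_add_distrib, sum_sub_distrib, h1, h2, sum_const, card_univ]
  have : (∑ x, if vdeg G x = k then 1 else 0 : ℤ) = degCount G k := by
    rw [degCount, card_filter]; push_cast; rfl
  rw [this]
  push_cast [nsmul_eq_mul]
  ring

theorem sum_card_fiber_le {α : Type*} (s : Finset α) (f : α → ℕ) (S : Finset ℕ) :
    ∑ k ∈ S, #{y ∈ s | f y = k} ≤ #s := by
  rw [← card_biUnion]
  · exact card_le_card (biUnion_subset.2 fun k _ => filter_subset _ _)
  · intro i _ j _ hij
    exact disjoint_filter.2 fun y _ h1 h2 => hij (h1.symm.trans h2)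

end Edges

/-! ### Degree distributions away from the exceptional vertex. -/

section EdgesMain

variable {V : Type*} [Fintype V] {G H : SimpleGraph V} {v : V}

/-- The number of vertices other than `v` of degree `k`. -/
noncomputable def otherDegCount (G : SimpleGraph V) (v : V) (k : ℕ) : ℕ :=
  #{y | y ≠ v ∧ vdeg G y = k}

/-- The number of vertices of degree `k` that are distinct from `v` and not adjacent to `v`. -/
noncomputable def nonNbrDegCount (G : SimpleGraph V) (v : V) (k : ℕ) : ℕ :=
  #{y | (y ≠ v ∧ ¬ G.Adj v y) ∧ vdeg G y = k}

theorem degCount_eq (G : SimpleGraph V) (v : V) (k : ℕ) :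
    (degCount G k : ℤ) = otherDegCount G v k + (if vdeg G v = k then 1 else 0) := by
  rw [degCount, ← card_filter_add_card_filter_not (p := fun y => y ≠ v), filter_filter,
    filter_filter, otherDegCount]
  push_cast
  congr 1
  · congr 2
    ext y
    simp [and_comm]
  · split_ifs with h
    · norm_cast
      rw [card_eq_one]
      refine ⟨v, ?_⟩
      ext y
      simp only [mem_filter, mem_univ, true_and, mem_singleton, not_not]
      exact ⟨fun h => h.2, fun e => ⟨e ▸ h, e⟩⟩
    · norm_cast
      rw [card_eq_zero, filter_eq_empty_iff]
      rintro y - ⟨h1, h2⟩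
      rw [not_not] at h2
      exact h (h2 ▸ h1)

theorem nbrDegCount_add_nonNbrDegCount (G : SimpleGraph V) (v : V) (k : ℕ) :
    nbrDegCount G v k + nonNbrDegCount G v k = otherDegCount G v k := by
  rw [otherDegCount, ← card_filter_add_card_filter_not (p := fun y => G.Adj v y), filter_filter,
    filter_filter, nbrDegCount, nonNbrDegCount]
  congr 2
  · ext y
    simp only [mem_filter, mem_univ, true_and]
    exact ⟨fun h => ⟨⟨h.1.ne', h.2⟩, h.1⟩, fun h => ⟨h.2, h.1.2⟩⟩
  · ext y
    simp only [mem_filter, mem_univ, true_and]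
    tauto

theorem card_nonNbr (G : SimpleGraph V) (v : V) :
    #{y | y ≠ v ∧ ¬ G.Adj v y} + vdeg G v + 1 = Fintype.card V := by
  have h1 : #{y | ¬ G.Adj v y} = #{y | y ≠ v ∧ ¬ G.Adj v y} + 1 := by
    rw [← card_erase_add_one (a := v) (by simp)]
    congr 2
    ext y
    simp
  have h2 := card_filter_add_card_filter_not (s := (univ : Finset V)) (p := fun y => G.Adj v y)
  rw [card_univ] at h2
  rw [vdeg]
  omega

theorem sum_nbrDegCount_le (G : SimpleGraph V) (v : V) (S : Finset ℕ) :
    ∑ k ∈ S, nbrDegCount G v k ≤ vdeg G v := by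
  have := sum_card_fiber_le ({y | G.Adj v y} : Finset V) (vdeg G) S
  simp only [filter_filter] at this
  exact this

theorem sum_nonNbrDegCount_le (G : SimpleGraph V) (v : V) (S : Finset ℕ) :
    ∑ k ∈ S, nonNbrDegCount G v k + vdeg G v + 1 ≤ Fintype.card V := by
  have := sum_card_fiber_le ({y | y ≠ v ∧ ¬ G.Adj v y} : Finset V) (vdeg G) S
  rw [← card_nonNbr G v]
  simp only [filter_filter] at this
  exact Nat.add_le_add_right (Nat.add_le_add_right this _) _

theorem HypomorphicExcept.sum_degCount_eq (h : HypomorphicExcept G H v) (k : ℕ) :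
    ((Fintype.card V : ℤ) - 1 - k) * degCount G k + (k + 1) * degCount G (k + 1) -
        cardDegCount G v k =
      ((Fintype.card V : ℤ) - 1 - k) * degCount H k + (k + 1) * degCount H (k + 1) -
        cardDegCount H v k := by
  rw [← sum_cardDegCount, ← sum_cardDegCount, ← add_sum_erase _ _ (mem_univ v),
    ← add_sum_erase (a := v) _ (cardDegCount H · k) (mem_univ v), add_sub_cancel_left,
    add_sub_cancel_left]
  refine sum_congr rfl fun x hx => ?_
  obtain ⟨σ, hσ⟩ := h x (ne_of_mem_erase hx)
  exact hσ.cardDegCount_eq k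

/-- The combined distribution of the degrees of the neighbours of `v` in `G` and the
non-neighbours of `v` in `H`. -/
noncomputable def mixedDegCount (G H : SimpleGraph V) (v : V) (k : ℕ) : ℤ :=
  nbrDegCount G v k + nonNbrDegCount H v k

theorem mixedDegCount_nonneg (G H : SimpleGraph V) (v : V) (k : ℕ) :
    0 ≤ mixedDegCount G H v k := by
  rw [mixedDegCount]; positivity

theorem nbrDegCount_add_le (G : SimpleGraph V) (x : V) (k : ℕ) :
    nbrDegCount G x k + (if vdeg G x = k then 1 else 0) ≤ degCount G k := by
  have h1 := nbrDegCount_add_nonNbrDegCount G x k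
  have h2 := degCount_eq G x k
  split_ifs at h2 ⊢ <;> omega

theorem sum_range_nbrDegCount (G : SimpleGraph V) (x : V) :
    ∑ k ∈ range (Fintype.card V), nbrDegCount G x k = vdeg G x := by
  have := card_eq_sum_card_fiberwise (s := ({y | G.Adj x y} : Finset V)) (f := vdeg G)
    (t := range (Fintype.card V)) (fun y _ => by simpa using vdeg_lt G y)
  simp only [filter_filter] at this
  exact this.symm

theorem otherDegCount_shift
    (hd : ∀ x, x ≠ v → vdeg G x = vdeg H x + 1) (j : ℕ) :
    otherDegCount H v j = otherDegCount G v (j + 1) := by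
  rw [otherDegCount, otherDegCount]
  congr 1
  ext y
  simp only [mem_filter, mem_univ, true_and]
  exact and_congr_right fun hy => by rw [hd y hy]; omega

/-- All cards but the one at v have equal total degree counts. Off v the degrees of H are those of G
lowered by 1, so everything is expressible through G, and trading neighbours of v in H for
non-neighbours leaves only the small mixed counts. -/
theorem HypomorphicExcept.degCount_recurrence (h : HypomorphicExcept G H v)
    (hd : ∀ x, x ≠ v → vdeg G x = vdeg H x + 1) (k : ℕ) :
    ((Fintype.card V : ℤ) - 2 - k) * (otherDegCount G v k - otherDegCount G v (k + 1)) +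
        k * (otherDegCount G v (k + 1) - otherDegCount G v (k + 2)) =
      ((Fintype.card V : ℤ) - 1 - k) *
          ((if vdeg H v = k then 1 else 0) - (if vdeg G v = k then 1 else 0)) +
        (k + 1) * ((if vdeg H v = k + 1 then 1 else 0) - (if vdeg G v = k + 1 then 1 else 0)) -
        mixedDegCount G H v k + mixedDegCount G H v (k + 1) := by
  have hshift := otherDegCount_shift hd
  have hE := h.sum_degCount_eq k
  have a1 := nbrDegCount_add_nonNbrDegCount H v k
  have a2 := nbrDegCount_add_nonNbrDegCount H v (k + 1)
  rw [hshift] at a1 a2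
  zify at a1 a2
  simp only [cardDegCount, degCount_eq _ v, hshift] at hE
  simp only [mixedDegCount]
  linear_combination hE + a1 - a2

theorem otherDegCount_zero (hd : ∀ x, x ≠ v → vdeg G x = vdeg H x + 1) :
    otherDegCount G v 0 = 0 := by
  rw [otherDegCount, card_eq_zero, filter_eq_empty_iff]
  rintro y - ⟨h1, h2⟩
  have := hd y h1
  omega

theorem otherDegCount_card (G : SimpleGraph V) (v : V) :
    otherDegCount G v (Fintype.card V) = 0 := by
  rw [otherDegCount, card_eq_zero, filter_eq_empty_iff]
  rintro y - ⟨h1, h2⟩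
  have := vdeg_lt G y
  omega

/-- There are deg_G v neighbours in G and n-1-deg_H v non-neighbours in H, together exactly 2. -/
theorem sum_mixedDegCount_le (hDc : vdeg H v + 3 = vdeg G v + Fintype.card V) (S : Finset ℕ) :
    ∑ k ∈ S, mixedDegCount G H v k ≤ 2 := by
  have h1 := sum_nbrDegCount_le G v S
  have h2 := sum_nonNbrDegCount_le H v S
  simp only [mixedDegCount, sum_add_distrib]
  zify at h1 h2 hDc
  omega

theorem HypomorphicExcept.false_of_vdeg_eq_zero (h : HypomorphicExcept G H v) {m : ℕ}
    (hm : Fintype.card V = m + 7) (hd : ∀ x, x ≠ v → vdeg G x = vdeg H x + 1)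
    (hc : vdeg G v = 0) (hDc : vdeg H v = vdeg G v + m + 4) : False := by
  have hE := h.degCount_recurrence hd
  have hl0 := otherDegCount_zero hd
  have hln := otherDegCount_card G v
  have hσ := sum_mixedDegCount_le (G := G) (H := H) (v := v) (by omega)
  have hσ0 := mixedDegCount_nonneg G H v
  rw [hm] at hE hln
  rw [hDc] at hE
  rw [hc] at hE
  have e0 := hE 0
  have e1 := hE 1
  have e2 := hE 2
  have e3 := hE 3
  have e4 := hE 4
  have hs := hσ (range 6)
  simp only [sum_range_succ, sum_range_zero, zero_add] at hs
  push_cast at e0 e1 e2 e3 e4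
  refine isolated_exception_arith (m + 5) (otherDegCount G v 0) (otherDegCount G v 1)
    (otherDegCount G v 2) (otherDegCount G v 3) (otherDegCount G v 4) (otherDegCount G v 5)
    (otherDegCount G v 6) (mixedDegCount G H v 0) (mixedDegCount G H v 1)
    (mixedDegCount G H v 2) (mixedDegCount G H v 3) (mixedDegCount G H v 4)
    (mixedDegCount G H v 5) (by omega) (by exact_mod_cast hl0) (by positivity) (by positivity)
    (by positivity) (by positivity) (by positivity) (hσ0 _) (hσ0 _) (hσ0 _) (hσ0 _) (hσ0 _)
    (hσ0 _) hs ?_ ?_ ?_ ?_ ?_ ?_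
  · linear_combination e0
  · linear_combination e1
  · linear_combination e2
  · intro hN
    obtain rfl : m = 0 := by omega
    norm_num at e3
    linear_combination e3
  · intro hN
    obtain rfl : m = 1 := by omega
    norm_num at e3
    linear_combination e3
  · intro hN
    obtain rfl : m = 1 := by omega
    norm_num at e4
    linear_combination e4

theorem HypomorphicExcept.seven_vertices_arith (h : HypomorphicExcept G H v)
    (hm : Fintype.card V = 7) (hd : ∀ x, x ≠ v → vdeg G x = vdeg H x + 1)
    (hc : vdeg G v = 1) (hDc : vdeg H v = 5) (s5 : mixedDegCount G H v 5 = 1)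
    (l0 : otherDegCount G v 0 = 0) (l1 : otherDegCount G v 1 = 0) (l6 : otherDegCount G v 6 = 0)
    (hl : (otherDegCount G v 2 = 1 ∧ otherDegCount G v 3 = 3 ∧ otherDegCount G v 4 = 0 ∧
        otherDegCount G v 5 = 2) ∨
      (otherDegCount G v 2 = 2 ∧ otherDegCount G v 3 = 0 ∧ otherDegCount G v 4 = 3 ∧
        otherDegCount G v 5 = 1)) : False := by
  have hshift := otherDegCount_shift hd
  have dG := degCount_eq G v
  have dH := degCount_eq H v
  rw [hc] at dG
  rw [hDc] at dH
  simp only [hshift] at dH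
  have g0 := dG 0
  have g1 := dG 1
  have g2 := dG 2
  have g3 := dG 3
  have g4 := dG 4
  have g5 := dG 5
  have h0 := dH 0
  have h1 := dH 1
  have h2 := dH 2
  have h3 := dH 3
  have h4 := dH 4
  have h5 := dH 5
  norm_num at g0 g1 g2 g3 g4 g5 h0 h1 h2 h3 h4 h5
  rcases hl with ⟨l2, l3, l4, l5⟩ | ⟨l2, l3, l4, l5⟩
  -- In the card at the vertex of degree 2 in G, equality of degree counts requires two neighbours
  -- in H, where this vertex has degree 1.
  · have hpos : 0 < otherDegCount G v 2 := by omega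
    obtain ⟨x, hx⟩ := card_pos.1 hpos
    simp only [mem_filter, mem_univ, true_and] at hx
    obtain ⟨σ, hσ⟩ := h x hx.1
    have hxH : vdeg H x = 1 := by have := hd x hx.1; omega
    have c0 := hσ.cardDegCount_eq 0
    have c1 := hσ.cardDegCount_eq 1
    have c2 := hσ.cardDegCount_eq 2
    have c3 := hσ.cardDegCount_eq 3
    have b0 := nbrDegCount_add_le G x 0
    have b0' := nbrDegCount_add_le H x 0
    have hS := sum_nbrDegCount_le H x (range 5)
    simp only [sum_range_succ, sum_range_zero, zero_add] at hS
    simp only [cardDegCount, hx.2, hxH] at c0 c1 c2 c3 b0 b0' hS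
    norm_num at c0 c1 c2 c3 b0 b0'
    omega
  -- No vertex of H other than v has degree 5, so `s5` produces a neighbour of v of degree 5 in G.
  -- Its card allows it only 1, 1 and 2 neighbours of degrees 1, 2 and 4: four instead of five.
  · have hpos : 0 < nbrDegCount G v 5 := by
      have := nbrDegCount_add_nonNbrDegCount H v 5
      rw [hshift] at this
      simp only [Nat.reduceAdd] at this
      simp only [mixedDegCount] at s5
      omega
    obtain ⟨x, hx⟩ := card_pos.1 hpos
    simp only [mem_filter, mem_univ, true_and] at hx
    have hxv : x ≠ v := hx.1.ne'
    obtain ⟨σ, hσ⟩ := h x hxv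
    have hxH : vdeg H x = 4 := by have := hd x hxv; omega
    have hx1 : 0 < nbrDegCount G x 1 := card_pos.2 ⟨v, by simp [hx.1.symm, hc]⟩
    have c0 := hσ.cardDegCount_eq 0
    have c1 := hσ.cardDegCount_eq 1
    have c2 := hσ.cardDegCount_eq 2
    have c3 := hσ.cardDegCount_eq 3
    have c4 := hσ.cardDegCount_eq 4
    have b0 := nbrDegCount_add_le G x 0
    have b1 := nbrDegCount_add_le G x 1
    have b3 := nbrDegCount_add_le G x 3
    have b5 := nbrDegCount_add_le G x 5
    have b0' := nbrDegCount_add_le H x 0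
    have b2' := nbrDegCount_add_le H x 2
    have b4' := nbrDegCount_add_le H x 4
    have b5' := nbrDegCount_add_le H x 5
    have hS := sum_range_nbrDegCount G x
    rw [hm] at hS
    have l6' : nbrDegCount G x 6 = 0 := by
      have := nbrDegCount_add_le G x 6
      have g6 := dG 6
      norm_num at g6
      omega
    simp only [sum_range_succ, sum_range_zero, zero_add] at hS
    simp only [cardDegCount, hx.2, hxH] at c0 c1 c2 c3 c4 b0 b1 b3 b5 b0' b2' b4' b5' hS
    norm_num at c0 c1 c2 c3 c4 b0 b1 b3 b5 b0' b2' b4' b5'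
    omega

theorem HypomorphicExcept.false_of_vdeg_eq_one (h : HypomorphicExcept G H v) {m : ℕ}
    (hm : Fintype.card V = m + 7) (hd : ∀ x, x ≠ v → vdeg G x = vdeg H x + 1)
    (hc : vdeg G v = 1) (hDc : vdeg H v = vdeg G v + m + 4) : False := by
  have hE := h.degCount_recurrence hd
  have hl0 := otherDegCount_zero hd
  have hln := otherDegCount_card G v
  have hσ := sum_mixedDegCount_le (G := G) (H := H) (v := v) (by omega)
  have hσ0 := mixedDegCount_nonneg G H v
  rw [hm] at hE hln
  rw [hDc] at hE
  rw [hc] at hE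
  have e0 := hE 0
  have e1 := hE 1
  have e2 := hE 2
  have e3 := hE 3
  have e4 := hE 4
  have e5 := hE 5
  have hs := hσ (range 7)
  simp only [sum_range_succ, sum_range_zero, zero_add] at hs
  push_cast at e0 e1 e2 e3 e4 e5
  obtain ⟨hN, s1, s5, l1, l6, hl⟩ := pendant_exception_arith (m + 5)
    (fun k => otherDegCount G v k) (mixedDegCount G H v) (by omega) (by exact_mod_cast hl0)
    (fun k => by positivity) hσ0 hs
    (by linear_combination e0)
    (by linear_combination e1)
    (by linear_combination e2)
    (by split_ifs at e3 <;> first | (exfalso; clear e3; omega) | linear_combination e3)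
    (by
      intro hN
      obtain rfl : m = 0 := by omega
      norm_num at e4
      linear_combination e4)
    (by
      intro hN
      obtain rfl : m = 0 := by omega
      norm_num at e5
      linear_combination e5)
    (by
      intro hN
      obtain rfl : m = 0 := by omega
      exact_mod_cast hln)
  obtain rfl : m = 0 := by omega
  refine h.seven_vertices_arith hm hd hc (by omega) s5 hl0 (by exact_mod_cast l1)
    (by exact_mod_cast l6) ?_
  norm_cast at hl

/-- Complementation exchanges this case with that of an isolated v, so the same arithmetic applies
with `l k` read at n-k and `s k` at n-1-k. -/
theorem HypomorphicExcept.false_of_vdeg_eq_two (h : HypomorphicExcept G H v) {m : ℕ}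
    (hm : Fintype.card V = m + 7) (hd : ∀ x, x ≠ v → vdeg G x = vdeg H x + 1)
    (hc : vdeg G v = 2) (hDc : vdeg H v = vdeg G v + m + 4) : False := by
  have hE := h.degCount_recurrence hd
  have hl0 := otherDegCount_zero hd
  have hln := otherDegCount_card G v
  have hσ := sum_mixedDegCount_le (G := G) (H := H) (v := v) (by omega)
  have hσ0 := mixedDegCount_nonneg G H v
  rw [hm] at hE hln
  rw [hDc] at hE
  rw [hc] at hE
  have e0 := hE (m + 5)
  have e1 := hE (m + 4)
  have e2 := hE (m + 3)
  have e3 := hE (m + 2)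
  have e4 := hE (m + 1)
  have hs : mixedDegCount G H v (m + 6) + mixedDegCount G H v (m + 5) +
      mixedDegCount G H v (m + 4) + mixedDegCount G H v (m + 3) + mixedDegCount G H v (m + 2) +
      mixedDegCount G H v (m + 1) ≤ 2 := by
    have := hσ (Ico (m + 1) (m + 7))
    rw [sum_Ico_eq_sum_range, show m + 7 - (m + 1) = 6 by omega] at this
    simp only [sum_range_succ, sum_range_zero, zero_add, add_assoc, Nat.reduceAdd] at this
    omega
  push_cast at e0 e1 e2 e3 e4
  refine isolated_exception_arith (m + 5) (otherDegCount G v (m + 7))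
    (otherDegCount G v (m + 6)) (otherDegCount G v (m + 5)) (otherDegCount G v (m + 4))
    (otherDegCount G v (m + 3)) (otherDegCount G v (m + 2)) (otherDegCount G v (m + 1))
    (mixedDegCount G H v (m + 6)) (mixedDegCount G H v (m + 5))
    (mixedDegCount G H v (m + 4)) (mixedDegCount G H v (m + 3)) (mixedDegCount G H v (m + 2))
    (mixedDegCount G H v (m + 1)) (by omega) (by exact_mod_cast hln) (by positivity)
    (by positivity) (by positivity) (by positivity) (by positivity) (hσ0 _) (hσ0 _) (hσ0 _)
    (hσ0 _) (hσ0 _) (hσ0 _) hs ?_ ?_ ?_ ?_ ?_ ?_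
  · split_ifs at e0 <;> first | (exfalso; clear e0; omega) | linear_combination -e0
  · split_ifs at e1 <;> first | (exfalso; clear e1; omega) | linear_combination -e1
  · split_ifs at e2 <;> first | (exfalso; clear e2; omega) | linear_combination -e2
  · intro hN
    obtain rfl : m = 0 := by omega
    norm_num at e3
    linear_combination -e3
  · intro hN
    obtain rfl : m = 1 := by omega
    norm_num at e3
    linear_combination -e3
  · intro hN
    obtain rfl : m = 1 := by omega
    norm_num at e4
    linear_combination -e4

theorem HypomorphicExcept.not_edges_lt (h : HypomorphicExcept G H v) (hn : 7 ≤ Fintype.card V) :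
    ¬ numCliques H 2 < numCliques G 2 := by
  intro hlt
  have hx := h.cliqueDeg_exception 2
  have hy := fun x (hx : x ≠ v) => h.cliqueDeg_eq_add 2 hx
  simp only [cliqueDeg_two] at hx hy
  have hD := vdeg_lt H v
  have ha : (numCliques G 2 : ℤ) - numCliques H 2 = 1 := by
    have h0 : 0 < (numCliques G 2 : ℤ) - numCliques H 2 := by omega
    generalize (numCliques G 2 : ℤ) - numCliques H 2 = a at *
    -- With a ≥ 2 the degree of v in H would be at least 2(n-3) > n-1.
    by_contra hne
    have : 2 ≤ a := by omega
    push_cast at hx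
    nlinarith
  rw [ha] at hx hy
  have hd : ∀ x, x ≠ v → vdeg G x = vdeg H x + 1 := fun x hxv => by have := hy x hxv; omega
  obtain ⟨m, hm⟩ : ∃ m, Fintype.card V = m + 7 := ⟨_, (Nat.sub_add_cancel hn).symm⟩
  rw [hm] at hx hD
  have hDc : vdeg H v = vdeg G v + m + 4 := by push_cast at hx; omega
  rcases (by omega : vdeg G v = 0 ∨ vdeg G v = 1 ∨ vdeg G v = 2) with hc | hc | hc
  · exact h.false_of_vdeg_eq_zero hm hd hc hDc
  · exact h.false_of_vdeg_eq_one hm hd hc hDc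
  · exact h.false_of_vdeg_eq_two hm hd hc hDc

theorem HypomorphicExcept.edges_eq (h : HypomorphicExcept G H v) (hn : 7 ≤ Fintype.card V) :
    numCliques G 2 = numCliques H 2 :=
  le_antisymm (not_lt.1 (h.not_edges_lt hn)) (not_lt.1 (h.symm.not_edges_lt hn))

end EdgesMain

/-! ### Vertex statistics that are shifted between two nearly hypomorphic graphs -/

section Shift

/-- The indicator of the set `{t, t - a, t - 2a, …}`. -/
noncomputable def downChain (a t s : ℤ) : ℤ := if ∃ i : ℕ, s = t - i * a then 1 else 0

theorem downChain_eq (a t s : ℤ) (ha : 0 < a) :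
    downChain a t s = downChain a t (s + a) + if s = t then 1 else 0 := by
  unfold downChain
  by_cases hst : s = t
  · subst hst
    rw [if_pos ⟨0, by simp⟩, if_pos rfl, if_neg, zero_add]
    rintro ⟨i, hi⟩
    have : (0 : ℤ) ≤ i * a := by positivity
    omega
  · rw [if_neg hst, add_zero]
    congr 1
    refine propext ⟨?_, ?_⟩
    · rintro ⟨i, hi⟩
      obtain _ | i := i
      · exact absurd (by simpa using hi) hst
      · exact ⟨i, by push_cast at hi; linear_combination hi⟩
    · rintro ⟨i, hi⟩
      exact ⟨i + 1, by push_cast; linear_combination hi⟩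

theorem downChain_of_lt {a t s : ℤ} (ha : 0 < a) (h : t < s) : downChain a t s = 0 := by
  rw [downChain, if_neg]
  rintro ⟨i, hi⟩
  have : (0 : ℤ) ≤ i * a := by positivity
  omega

theorem downChain_nonneg (a t s : ℤ) : 0 ≤ downChain a t s := by
  unfold downChain; split_ifs <;> norm_num

theorem downChain_le_one (a t s : ℤ) : downChain a t s ≤ 1 := by
  unfold downChain; split_ifs <;> norm_num

theorem downChain_sub (a t : ℤ) (i : ℕ) : downChain a t (t - i * a) = 1 :=
  if_pos ⟨i, rfl⟩

theorem exists_of_downChain_pos {a t s : ℤ} (h : 0 < downChain a t s) :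
    ∃ i : ℕ, s = t - i * a := by
  unfold downChain at h
  by_contra hne
  rw [if_neg hne] at h
  exact lt_irrefl _ h

/-- Uniqueness for f(t) - f(t+a) = c(t) among functions vanishing far up; `downChain` supplies the
solution for a point mass c. -/
theorem eq_zero_of_periodic_of_eventually_zero {a : ℤ} (ha : 0 < a) (f : ℤ → ℤ) (B : ℤ)
    (hp : ∀ t, f t = f (t + a)) (hB : ∀ t, B < t → f t = 0) (t : ℤ) : f t = 0 := by
  have h : ∀ i : ℕ, f t = f (t + i * a) := by
    intro i
    induction i with
    | zero => simp
    | succ i ih => rw [ih, hp]; push_cast; ring_nf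
  rw [h (B - t).toNat.succ]
  apply hB
  have h1 : B - t ≤ (B - t).toNat := Int.self_le_toNat _
  push_cast
  nlinarith [Int.natCast_nonneg (B - t).toNat]

variable {V : Type*} [Fintype V]

/-- The non-neighbours of `x` in `A`. -/
noncomputable def nonNbrsIn (G : SimpleGraph V) (A : Finset V) (x : V) : Finset V :=
  {u ∈ A | u ≠ x ∧ ¬ G.Adj x u}

/-- The vertices of `A` all have `K` non-neighbours in `G` and in `H`, and the statistic `gG` of
`G` exceeds the statistic `gH` of `H` by `a`, except at `v`, where it falls short by `L * a`;
the distributions of the statistics over the non-neighbours in `A` of any other vertex agree. -/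
structure IsShifted (G H : SimpleGraph V) (v : V) (A : Finset V) (K L : ℕ) (a : ℤ)
    (gG gH : V → ℤ) : Prop where
  pos : 0 < a
  shift : ∀ x, x ≠ v → gG x = gH x + a
  exception : gH v = gG v + L * a
  card_left : ∀ x ∈ A, #{u | u ≠ x ∧ ¬ G.Adj x u} = K
  card_right : ∀ x ∈ A, #{u | u ≠ x ∧ ¬ H.Adj x u} = K
  dist : ∀ x, x ≠ v → ∀ (p : ℤ → Prop) [DecidablePred p],
    #{u ∈ nonNbrsIn G A x | p (gG u)} = #{u ∈ nonNbrsIn H A x | p (gH u)}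

theorem sum_card_nonNbrsIn (G : SimpleGraph V) (A : Finset V) (K : ℕ) (g : V → ℤ)
    (h : ∀ x ∈ A, #{u | u ≠ x ∧ ¬ G.Adj x u} = K) (p : ℤ → Prop) [DecidablePred p] :
    ∑ x, #{u ∈ nonNbrsIn G A x | p (g u)} = K * #{u ∈ A | p (g u)} := by
  have h1 : ∀ x, #{u ∈ nonNbrsIn G A x | p (g u)} =
      ∑ u ∈ A with p (g u), if u ≠ x ∧ ¬ G.Adj x u then 1 else 0 := by
    intro x
    rw [← card_filter, nonNbrsIn, filter_filter, filter_filter]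
    congr 1
    ext u
    simp only [mem_filter]
    tauto
  simp only [h1]
  rw [sum_comm, mul_comm, ← smul_eq_mul, ← sum_const]
  refine sum_congr rfl fun u hu => ?_
  rw [← card_filter, ← h u (mem_filter.1 hu).1]
  congr 1
  ext x
  simp only [mem_filter, mem_univ, true_and, G.adj_comm, ne_comm]

namespace IsShifted

variable {G H : SimpleGraph V} {v : V} {A : Finset V} {K L : ℕ} {a : ℤ} {gG gH : V → ℤ}

/-- Sum the distributions over all x: each u in A is counted once for each of its K non-neighbours,
and only the terms at x = v can differ. -/
theorem weights (h : IsShifted G H v A K L a gG gH) (p : ℤ → Prop) [DecidablePred p] :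
    K * #{u ∈ A | p (gG u)} + #{u ∈ nonNbrsIn H A v | p (gH u)} =
      K * #{u ∈ A | p (gH u)} + #{u ∈ nonNbrsIn G A v | p (gG u)} := by
  rw [← sum_card_nonNbrsIn G A K gG h.card_left p, ← sum_card_nonNbrsIn H A K gH h.card_right p,
    ← add_sum_erase _ _ (mem_univ v),
    ← add_sum_erase (a := v) _ (fun x => #{u ∈ nonNbrsIn H A x | p (gH u)}) (mem_univ v),
    sum_congr rfl fun x hx => h.dist x (ne_of_mem_erase hx) p]
  omega

theorem card_nonNbrsIn_eq (h : IsShifted G H v A K L a gG gH) :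
    #(nonNbrsIn G A v) = #(nonNbrsIn H A v) := by
  have := h.weights (fun _ => True)
  simp only [filter_true] at this
  omega

theorem card_nonNbrsIn_le (h : IsShifted G H v A K L a gG gH) (hv : v ∈ A) :
    #(nonNbrsIn G A v) ≤ K := by
  rw [← h.card_left v hv]
  refine card_le_card fun u hu => ?_
  simp only [nonNbrsIn, mem_filter, mem_univ, true_and] at hu ⊢
  exact hu.2

/-- The number of vertices of `A` other than `v` at level `t`. -/
noncomputable def lam (A : Finset V) (v : V) (gG : V → ℤ) (t : ℤ) : ℕ :=
  #{u ∈ A | u ≠ v ∧ gG u = t}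

theorem lam_shift (h : IsShifted G H v A K L a gG gH) (t : ℤ) :
    lam A v gH t = lam A v gG (t + a) := by
  rw [lam, lam]
  congr 1
  ext u
  simp only [mem_filter]
  exact and_congr_right fun _ => and_congr_right fun hu => by rw [h.shift u hu]; omega

theorem exists_bound (A : Finset V) (v : V) (g : V → ℤ) : ∃ B, ∀ t, B < t → lam A v g t = 0 := by
  refine ⟨∑ u, |g u|, fun t ht => ?_⟩
  rw [lam, card_eq_zero, filter_eq_empty_iff]
  rintro u - ⟨-, rfl⟩
  have := single_le_sum (f := fun u => |g u|) (fun i _ => abs_nonneg _) (mem_univ u)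
  exact absurd ((le_abs_self _).trans this) (not_le.2 ht)

theorem level_card {V : Type*} {A : Finset V} {v : V} (hv : v ∈ A) (g : V → ℤ) (t : ℤ) :
    #{u ∈ A | g u = t} = lam A v g t + if g v = t then 1 else 0 := by
  rw [lam, ← card_filter_add_card_filter_not (p := fun u => u ≠ v), filter_filter, filter_filter]
  congr 1
  · congr 1
    ext u
    simp only [mem_filter]
    tauto
  · split_ifs with ht
    · rw [card_eq_one]
      refine ⟨v, ?_⟩
      ext u
      simp only [mem_filter, not_not, mem_singleton]
      exact ⟨fun h => h.2.2, fun e => ⟨e ▸ hv, e ▸ ht, e⟩⟩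
    · rw [card_eq_zero, filter_eq_empty_iff]
      rintro u - ⟨h1, h2⟩
      rw [not_not] at h2
      exact ht (h2 ▸ h1)

/-- If the exceptional vertex lies outside `A`, then `A` is empty. -/
theorem false_of_notMem (h : IsShifted G H v A K L a gG gH) (hv : v ∉ A) (hA : A.Nonempty)
    (hK : 0 < K) (hC : K = 1 → ∃ C, (∀ u ∈ nonNbrsIn G A v, gG u = C) ∧
      ∀ u ∈ nonNbrsIn H A v, gH u = C) : False := by
  obtain ⟨m, hm, hmax⟩ := exists_max_image A gG hA
  have hw := h.weights (fun s => s = gG m)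
  -- On A the statistic of H is lower by a, so it never attains the maximum for G.
  have h0 : #{u ∈ A | gH u = gG m} = 0 := by
    rw [card_eq_zero, filter_eq_empty_iff]
    intro u hu e
    have h1 := h.shift u (fun e => hv (e ▸ hu))
    have h2 := hmax u hu
    have := h.pos
    omega
  have hpos : 0 < #{u ∈ A | gG u = gG m} := card_pos.2 ⟨m, by simp [hm]⟩
  have hle : #{u ∈ nonNbrsIn G A v | gG u = gG m} ≤ #{u ∈ A | gG u = gG m} :=
    card_le_card (filter_subset_filter _ (filter_subset _ _))
  simp only [h0, mul_zero, zero_add] at hw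
  rcases (by omega : K = 1 ∨ 2 ≤ K) with h1 | h2
  · obtain ⟨C, hC1, hC2⟩ := hC h1
    have heq : #{u ∈ nonNbrsIn G A v | gG u = gG m} = #{u ∈ nonNbrsIn H A v | gH u = gG m} := by
      by_cases hCm : C = gG m
      · rw [filter_true_of_mem fun u hu => (hC1 u hu).trans hCm,
          filter_true_of_mem fun u hu => (hC2 u hu).trans hCm, h.card_nonNbrsIn_eq]
      · rw [filter_false_of_mem fun u hu e => hCm ((hC1 u hu).symm.trans e),
          filter_false_of_mem fun u hu e => hCm ((hC2 u hu).symm.trans e)]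
    subst h1
    omega
  · nlinarith

theorem weights_level (h : IsShifted G H v A K L a gG gH) (hv : v ∈ A) (t : ℤ) :
    K * (lam A v gG t + if gG v = t then 1 else 0) + #{u ∈ nonNbrsIn H A v | gH u = t} =
      K * (lam A v gG (t + a) + if gH v = t then 1 else 0) +
        #{u ∈ nonNbrsIn G A v | gG u = t} := by
  rw [← h.lam_shift, ← level_card hv, ← level_card hv]
  exact h.weights (fun s => s = t)

/-- Either the level sizes of `G` and `H` agree, or the non-neighbours of `v` lie in `A` and all
have the same level, and the two levels in `G` and in `H` are different. -/
theorem levels_dichotomy (h : IsShifted G H v A K L a gG gH) (hv : v ∈ A) (hK : 0 < K) :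
    (∀ t, lam A v gG t + (if gG v = t then 1 else 0) =
      lam A v gG (t + a) + if gH v = t then 1 else 0) ∨
    ∃ s₀ s₁, s₀ ≠ s₁ ∧ (∀ u ∈ nonNbrsIn G A v, gG u = s₀) ∧ (∀ u ∈ nonNbrsIn H A v, gH u = s₁) ∧
      #(nonNbrsIn G A v) = K ∧ #(nonNbrsIn H A v) = K := by
  by_cases hall : ∀ t, lam A v gG t + (if gG v = t then 1 else 0) =
      lam A v gG (t + a) + if gH v = t then 1 else 0
  · exact Or.inl hall
  right
  push Not at hall
  obtain ⟨t, ht⟩ := hall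
  have hw := h.weights_level hv
  have hN := h.card_nonNbrsIn_eq
  have hNK := h.card_nonNbrsIn_le hv
  have fle : ∀ (F : SimpleGraph V) (g : V → ℤ) (s : ℤ),
      #{u ∈ nonNbrsIn F A v | g u = s} ≤ #(nonNbrsIn F A v) := fun F g s =>
    card_le_card (filter_subset _ _)
  have full : ∀ (F : SimpleGraph V) (g : V → ℤ) (s : ℤ),
      #{u ∈ nonNbrsIn F A v | g u = s} = #(nonNbrsIn F A v) →
        ∀ u ∈ nonNbrsIn F A v, g u = s := fun F g s hc =>
    filter_card_eq hc
  have none : ∀ (F : SimpleGraph V) (g : V → ℤ) (s s' : ℤ), s' ≠ s →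
      (∀ u ∈ nonNbrsIn F A v, g u = s) → #{u ∈ nonNbrsIn F A v | g u = s'} = 0 := by
    intro F g s s' hne hs
    rw [card_eq_zero, filter_eq_empty_iff]
    exact fun u hu e => hne (e.symm.trans (hs u hu))
  have ex : ∀ (F : SimpleGraph V) (g : V → ℤ), 0 < #(nonNbrsIn F A v) →
      ∃ s, 0 < #{u ∈ nonNbrsIn F A v | g u = s} := by
    intro F g hF
    obtain ⟨z, hz⟩ := card_pos.1 hF
    exact ⟨g z, card_pos.2 ⟨z, by simp [hz]⟩⟩
  have h1 := fle G gG t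
  have h2 := fle H gH t
  have hwt := hw t
  generalize hx : lam A v gG t + (if gG v = t then 1 else 0) = x at ht hwt
  generalize hy : lam A v gG (t + a) + (if gH v = t then 1 else 0) = y at ht hwt
  rcases lt_or_gt_of_ne ht with hlt | hlt
  -- Level sizes that differ do so by at least 1, hence by K in the weighted identity, which all the
  -- at most K non-neighbours of v are needed to balance.
  · have h3 : K * x + K ≤ K * y := by nlinarith
    have h4 : #(nonNbrsIn H A v) = K := by omega
    have hf := full H gH t (by omega)
    obtain ⟨s₀, hs⟩ := ex G gG (by omega)
    have hne : s₀ ≠ t := by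
      rintro rfl
      omega
    have h5 := hw s₀
    rw [none H gH t s₀ hne hf] at h5
    refine ⟨s₀, t, hne, full G gG s₀ ?_, hf, by omega, by omega⟩
    have h6 := fle G gG s₀
    -- A positive multiple of K that is at most K: the non-neighbours cannot be spread over several
    -- levels.
    have h7 : K ∣ #{u ∈ nonNbrsIn G A v | gG u = s₀} :=
      (Nat.dvd_add_right (dvd_mul_right K _)).1 (Dvd.intro _ h5)
    have := Nat.le_of_dvd hs h7
    omega
  · have h3 : K * y + K ≤ K * x := by nlinarith
    have h4 : #(nonNbrsIn G A v) = K := by omega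
    have hf := full G gG t (by omega)
    obtain ⟨s₁, hs⟩ := ex H gH (by omega)
    have hne : s₁ ≠ t := by
      rintro rfl
      omega
    have h5 := hw s₁
    rw [none G gG t s₁ hne hf] at h5
    refine ⟨t, s₁, hne.symm, hf, full H gH s₁ ?_, by omega, by omega⟩
    have h6 := fle H gH s₁
    have h7 : K ∣ #{u ∈ nonNbrsIn H A v | gH u = s₁} :=
      (Nat.dvd_add_right (dvd_mul_right K _)).1 (Dvd.intro _ h5.symm)
    have := Nat.le_of_dvd hs h7
    omega

end IsShifted
end Shift

/-! ### Non-adjacent pairs between levels. -/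

section ShiftMain

/-- The number of ordered pairs of distinct non-adjacent vertices of `A` at the levels `s`, `t`. -/
noncomputable def crossCount {V : Type*} (G : SimpleGraph V) (A : Finset V) (g : V → ℤ)
    (s t : ℤ) : ℕ :=
  #{p ∈ A ×ˢ A | (p.2 ≠ p.1 ∧ ¬ G.Adj p.1 p.2) ∧ g p.1 = s ∧ g p.2 = t}

theorem crossCount_comm {V : Type*} (G : SimpleGraph V) (A : Finset V) (g : V → ℤ) (s t : ℤ) :
    crossCount G A g s t = crossCount G A g t s := by
  refine Finset.card_equiv (Equiv.prodComm V V) fun p => ?_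
  simp only [mem_filter, mem_product, Equiv.prodComm_apply, Prod.fst_swap, Prod.snd_swap,
    G.adj_comm p.2 p.1, ne_comm (a := p.1)]
  tauto

theorem crossCount_eq_sum {V : Type*} (G : SimpleGraph V) (A : Finset V) (g : V → ℤ) (s t : ℤ) :
    crossCount G A g s t = ∑ x ∈ A with g x = s, #{u ∈ nonNbrsIn G A x | g u = t} := by
  rw [crossCount, card_filter, sum_product, sum_filter]
  refine sum_congr rfl fun x _ => ?_
  rw [← card_filter]
  split_ifs with hx
  · rw [nonNbrsIn, filter_filter]
    simp [hx]
  · simp [hx]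

theorem crossCount_eq_zero_of_card_le_one {V : Type*} (G : SimpleGraph V) (A : Finset V)
    (g : V → ℤ) (s : ℤ) (h : #{u ∈ A | g u = s} ≤ 1) : crossCount G A g s s = 0 := by
  rw [crossCount, card_eq_zero, filter_eq_empty_iff]
  rintro p hp ⟨⟨h1, -⟩, h2, h3⟩
  rw [mem_product] at hp
  exact h1 (card_le_one.1 h _ (by simp [hp.2, h3]) _ (by simp [hp.1, h2]))

namespace IsShifted

variable {V : Type*} [Fintype V]
variable {G H : SimpleGraph V} {v : V} {A : Finset V} {K L : ℕ} {a : ℤ} {gG gH : V → ℤ}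

/-- Away from v, the vertices at level s in G are those at level s - a in H, and each has equally
distributed non-neighbours in both graphs. -/
theorem crossCount_shift (h : IsShifted G H v A K L a gG gH) {s : ℤ} (t : ℤ) (h1 : s ≠ gG v)
    (h2 : s - a ≠ gH v) : crossCount G A gG s t = crossCount H A gH (s - a) t := by
  rw [crossCount_eq_sum, crossCount_eq_sum]
  have hf : ({x ∈ A | gG x = s} : Finset V) = {x ∈ A | gH x = s - a} := by
    ext x
    simp only [mem_filter]
    refine and_congr_right fun _ => ?_
    by_cases hx : x = v
    · subst hx
      exact ⟨fun e => absurd e.symm h1, fun e => absurd e.symm h2⟩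
    · rw [h.shift x hx]; omega
  rw [← hf]
  refine sum_congr rfl fun x hx => h.dist x ?_ (fun s => s = t)
  rintro rfl
  exact h1 (mem_filter.1 hx).2.symm

/-- Non-adjacent pairs of `G` between the levels `gH v - i * a` and `gH v - j * a`. -/
theorem cross_left (h : IsShifted G H v A K L a gG gH) {i : ℕ} (hi : i < L) (t : ℤ) :
    crossCount G A gG (gH v - i * a) t = crossCount H A gH (gH v - (i + 1 : ℕ) * a) t := by
  have ha := h.pos
  have he := h.exception
  have hi' : (i : ℤ) + 1 ≤ L := by exact_mod_cast hi
  rw [h.crossCount_shift t]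
  · congr 1
    push_cast
    ring
  · intro e
    nlinarith
  · intro e
    nlinarith [Int.natCast_nonneg i]

/-- Passing to H and back, once from each side of the pair: the counts for G are constant along
antidiagonals of level indices. -/
theorem cross_diag (h : IsShifted G H v A K L a gG gH) {i j : ℕ} (hi : i < L) (hj : j < L) :
    crossCount G A gG (gH v - (i + 1 : ℕ) * a) (gH v - j * a) =
      crossCount G A gG (gH v - i * a) (gH v - (j + 1 : ℕ) * a) := by
  rw [h.cross_left hi, crossCount_comm H, ← h.cross_left hj, crossCount_comm]

/-- One formula for both alternatives of `levels_dichotomy`: ε = 0 when the level sizes agree, ε = 1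
when the non-neighbours of v sit on the levels s₀ and s₁. -/
theorem lam_eq (h : IsShifted G H v A K L a gG gH) (s₀ s₁ ε : ℤ)
    (hd : ∀ t, (lam A v gG t : ℤ) + (if gG v = t then 1 else 0) =
      lam A v gG (t + a) + (if gH v = t then 1 else 0) +
        ε * ((if t = s₀ then 1 else 0) - if t = s₁ then 1 else 0)) (t : ℤ) :
    (lam A v gG t : ℤ) = downChain a (gH v) t - downChain a (gG v) t +
      ε * (downChain a s₀ t - downChain a s₁ t) := by
  obtain ⟨B, hB⟩ := exists_bound A v gG
  have key := eq_zero_of_periodic_of_eventually_zero h.pos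
    (fun t => (lam A v gG t : ℤ) - (downChain a (gH v) t - downChain a (gG v) t +
      ε * (downChain a s₀ t - downChain a s₁ t)))
    (max B (max (max (gH v) (gG v)) (max s₀ s₁))) ?_ ?_ t
  · exact sub_eq_zero.1 key
  · intro t
    have h0 := hd t
    simp only [eq_comm (a := gG v), eq_comm (a := gH v)] at h0
    linear_combination h0 - downChain_eq a (gH v) t h.pos + downChain_eq a (gG v) t h.pos -
      ε * downChain_eq a s₀ t h.pos + ε * downChain_eq a s₁ t h.pos
  · intro t ht
    simp only [max_lt_iff] at ht
    obtain ⟨h1, ⟨h2, h3⟩, h4, h5⟩ := ht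
    simp only [hB t h1, downChain_of_lt h.pos h2, downChain_of_lt h.pos h3,
      downChain_of_lt h.pos h4, downChain_of_lt h.pos h5]
    simp

/-- A point of the chain below `gH v` that is not in the chain below `gG v`. -/
theorem exists_index (h : IsShifted G H v A K L a gG gH) {t : ℤ}
    (h1 : downChain a (gH v) t = 1) (h2 : downChain a (gG v) t = 0) :
    ∃ i : ℕ, i < L ∧ t = gH v - i * a := by
  obtain ⟨i, hi⟩ := exists_of_downChain_pos (h1 ▸ one_pos)
  refine ⟨i, ?_, hi⟩
  by_contra hL
  have : downChain a (gG v) t = 1 := by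
    have := downChain_sub a (gG v) (i - L)
    rwa [show gG v - ((i - L : ℕ) : ℤ) * a = t by
      rw [hi, h.exception, Nat.cast_sub (not_lt.1 hL)]; ring] at this
  omega

theorem false_of_exotic (h : IsShifted G H v A K L a gG gH) (hv : v ∈ A) (hK : 0 < K)
    (hnK : ∀ x ∈ A, x ≠ v → #(nonNbrsIn G A x) < K) (s₀ s₁ : ℤ)
    (hs₀ : ∀ u ∈ nonNbrsIn G A v, gG u = s₀) (hs₁ : ∀ u ∈ nonNbrsIn H A v, gH u = s₁)
    (hG : #(nonNbrsIn G A v) = K) (hH : #(nonNbrsIn H A v) = K) : False := by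
  have ha := h.pos
  have nu : ∀ (F : SimpleGraph V) (g : V → ℤ) (s t : ℤ), #(nonNbrsIn F A v) = K →
      (∀ u ∈ nonNbrsIn F A v, g u = s) →
      #{u ∈ nonNbrsIn F A v | g u = t} = if t = s then K else 0 := by
    intro F g s t hF hs
    split_ifs with hts
    · rw [filter_true_of_mem fun u hu => (hs u hu).trans hts.symm, hF]
    · rw [card_eq_zero, filter_eq_empty_iff]
      exact fun u hu e => hts (e.symm.trans (hs u hu))
  have hlam := h.lam_eq s₀ s₁ 1 (fun t => by
    have hw := h.weights_level hv t
    rw [nu G gG s₀ t hG hs₀, nu H gH s₁ t hH hs₁] at hw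
    have hK' : (K : ℤ) ≠ 0 := by exact_mod_cast hK.ne'
    refine mul_left_cancel₀ hK' ?_
    zify at hw
    have e0 : (if t = s₀ then (K : ℤ) else 0) = K * if t = s₀ then 1 else 0 := by
      split_ifs <;> simp
    have e1 : (if t = s₁ then (K : ℤ) else 0) = K * if t = s₁ then 1 else 0 := by
      split_ifs <;> simp
    rw [e0, e1] at hw
    linear_combination hw)
  obtain ⟨u, hu⟩ := card_pos.1 (hG ▸ hK)
  have hu' := hu
  simp only [nonNbrsIn, mem_filter] at hu'
  have hvu : v ∈ nonNbrsIn G A u := by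
    simp only [nonNbrsIn, mem_filter]
    exact ⟨hv, hu'.2.1.symm, fun e => hu'.2.2 e.symm⟩
  have hK2 : 2 ≤ K := by
    have h1 := hnK u hu'.1 hu'.2.1
    have h2 := card_pos.2 ⟨v, hvu⟩
    omega
  have lam0 : K ≤ lam A v gG s₀ := by
    rw [← hG, lam]
    refine card_le_card fun w hw => ?_
    have hw' := hw
    simp only [nonNbrsIn, mem_filter] at hw' ⊢
    exact ⟨hw'.1, hw'.2.1, hs₀ w hw⟩
  have lam1 : K ≤ lam A v gG (s₁ + a) := by
    rw [← hH, lam]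
    refine card_le_card fun w hw => ?_
    have hw' := hw
    simp only [nonNbrsIn, mem_filter] at hw' ⊢
    exact ⟨hw'.1, hw'.2.1, by rw [h.shift w hw'.2.1, hs₁ w hw]⟩
  -- Only two chains enter with a positive sign, so a level with at least K ≥ 2 vertices has exactly
  -- two and lies on both.
  have two : ∀ t, K ≤ lam A v gG t → downChain a (gH v) t = 1 ∧ downChain a (gG v) t = 0 ∧
      downChain a s₀ t = 1 ∧ lam A v gG t = 2 := by
    intro t ht
    have := hlam t
    have := downChain_nonneg a (gG v) t
    have := downChain_nonneg a s₁ t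
    have := downChain_le_one a (gH v) t
    have := downChain_le_one a s₀ t
    omega
  obtain ⟨a1, a2, -, a4⟩ := two s₀ lam0
  obtain ⟨b1, b2, b3, -⟩ := two _ lam1
  obtain ⟨j, hjL, hj⟩ := h.exists_index a1 a2
  obtain ⟨i, hiL, hi⟩ := h.exists_index b1 b2
  obtain ⟨d, hd⟩ := exists_of_downChain_pos (b3 ▸ one_pos)
  have hijd : i = j + d := by
    have : (i : ℤ) = j + d := by
      refine mul_right_cancel₀ ha.ne' ?_
      linear_combination hi - hd - hj
    exact_mod_cast this
  obtain rfl : K = 2 := by omega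
  have hlevel : ({x ∈ A | gG x = s₀} : Finset V) = nonNbrsIn G A v := by
    have hsub : nonNbrsIn G A v ⊆ ({x ∈ A | x ≠ v ∧ gG x = s₀} : Finset V) := by
      intro w hw
      have hw' := hw
      simp only [nonNbrsIn, mem_filter] at hw' ⊢
      exact ⟨hw'.1, hw'.2.1, hs₀ w hw⟩
    rw [eq_of_subset_of_card_le hsub (by rw [hG]; exact a4.le)]
    ext x
    simp only [mem_filter]
    refine and_congr_right fun _ => ⟨fun e => ⟨?_, e⟩, fun e => e.2⟩
    rintro rfl
    have he := h.exception
    have hj' : (j : ℤ) + 1 ≤ L := by exact_mod_cast hjL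
    nlinarith
  -- The two vertices at level s₀ have fewer than K = 2 non-neighbours in A, so v is the only one.
  have hzero : ∀ t, t ≠ gG v → crossCount G A gG s₀ t = 0 := by
    intro t ht
    rw [crossCount_eq_sum, hlevel]
    refine sum_eq_zero fun x hx => ?_
    have hx' := hx
    simp only [nonNbrsIn, mem_filter] at hx'
    have hvx : v ∈ nonNbrsIn G A x := by
      simp only [nonNbrsIn, mem_filter]
      exact ⟨hv, hx'.2.1.symm, fun e => hx'.2.2 e.symm⟩
    have h1 := hnK x hx'.1 hx'.2.1
    rw [card_eq_zero, filter_eq_empty_iff]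
    intro w hw e
    have := card_le_one.1 (Nat.le_of_lt_succ h1) w hw v hvx
    exact ht (by rw [← e, this])
  have hchain : ∀ e k : ℕ, k + e < L → crossCount G A gG (gH v - (k + e : ℕ) * a) (gH v - (0 : ℕ) * a)
      = crossCount G A gG (gH v - k * a) (gH v - e * a) := by
    intro e
    induction e with
    | zero => intro k _; simp
    | succ e ih =>
      intro k hk
      have h1 := ih (k + 1) (by omega)
      rw [show k + 1 + e = k + (e + 1) by omega] at h1
      rw [h1, h.cross_diag (by omega) (by omega)]
  -- Sliding along the antidiagonal moves this count to G at s₀ and a level above that of v, where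
  -- it vanishes; yet v has non-neighbours at s₁ in H.
  have hfin : crossCount H A gH (gH v) s₁ = 0 := by
    rw [crossCount_comm]
    have h1 := h.cross_left hiL (gH v)
    rw [show gH v - ((i + 1 : ℕ) : ℤ) * a = s₁ by push_cast; linear_combination -hi] at h1
    rw [← h1, hijd]
    have h2 := hchain d j (by omega)
    rw [← hj] at h2
    simp only [Nat.cast_zero, zero_mul, sub_zero] at h2
    rw [h2]
    refine hzero _ fun e => ?_
    have he := h.exception
    have hd' : (d : ℤ) + 1 ≤ L := by
      have : d < L := by omega
      exact_mod_cast this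
    nlinarith
  obtain ⟨w, hw⟩ := card_pos.1 (hH ▸ hK)
  have hw' := hw
  simp only [nonNbrsIn, mem_filter] at hw'
  rw [crossCount, card_eq_zero, filter_eq_empty_iff] at hfin
  exact hfin (x := (v, w)) (mem_product.2 ⟨hv, hw'.1⟩) ⟨hw'.2, rfl, hs₁ w hw⟩

/-- The set `A` is a clique of `L + 1` vertices, distinguished by their statistic. -/
theorem isClique (h : IsShifted G H v A K L a gG gH) (hv : v ∈ A) (hK : 0 < K)
    (hnK : ∀ x ∈ A, x ≠ v → #(nonNbrsIn G A x) < K) :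
    #A = L + 1 ∧ (∀ x ∈ A, ∀ y ∈ A, gG x = gG y → x = y) ∧
      ∀ x ∈ A, ∀ y ∈ A, y ≠ x → G.Adj x y := by
  rcases h.levels_dichotomy hv hK with hd | ⟨s₀, s₁, -, h1, h2, h3, h4⟩
  swap
  · exact (h.false_of_exotic hv hK hnK s₀ s₁ h1 h2 h3 h4).elim
  have ha := h.pos
  have he := h.exception
  have hlam := h.lam_eq 0 0 0 (fun t => by have := hd t; zify at this; linarith)
  have hlev : ∀ t, (#{u ∈ A | gG u = t} : ℤ) =
      downChain a (gH v) t - downChain a (gG v) (t + a) := by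
    intro t
    rw [level_card hv]
    push_cast
    rw [hlam, downChain_eq a (gG v) t ha]
    simp only [eq_comm (a := gG v)]
    ring
  have hle : ∀ t, #{u ∈ A | gG u = t} ≤ 1 := by
    intro t
    have := hlev t
    have := downChain_le_one a (gH v) t
    have := downChain_nonneg a (gG v) (t + a)
    omega
  have hleH : ∀ t, #{u ∈ A | gH u = t} ≤ 1 := by
    intro t
    have h1 := hle t
    rw [level_card hv] at h1 ⊢
    rw [h.lam_shift, ← hd t]
    exact h1
  have hinj : ∀ x ∈ A, ∀ y ∈ A, gG x = gG y → x = y := fun x hx y hy hxy =>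
    card_le_one.1 (hle (gG y)) x (by simp [hx, hxy]) y (by simp [hy])
  have hidx : ∀ x ∈ A, ∃ i : ℕ, i ≤ L ∧ gG x = gH v - i * a := by
    intro x hx
    have h1 : 0 < #{u ∈ A | gG u = gG x} := card_pos.2 ⟨x, by simp [hx]⟩
    have h2 := hlev (gG x)
    have h3 := downChain_le_one a (gH v) (gG x)
    have h4 := downChain_nonneg a (gG v) (gG x + a)
    obtain ⟨i, hi⟩ := exists_of_downChain_pos (a := a) (t := gH v) (s := gG x) (by omega)
    refine ⟨i, ?_, hi⟩
    by_contra hL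
    push Not at hL
    have := downChain_sub a (gG v) (i - (L + 1))
    rw [show gG v - ((i - (L + 1) : ℕ) : ℤ) * a = gG x + a by
      rw [hi, he, Nat.cast_sub hL]; push_cast; ring] at this
    omega
  -- Distance 0 vanishes since levels of G are singletons, distance 1 since those of H are; the
  -- antidiagonal rule reduces d + 2 to d.
  have hcross : ∀ d i : ℕ, i + d ≤ L →
      crossCount G A gG (gH v - i * a) (gH v - (i + d : ℕ) * a) = 0 := by
    intro d
    induction d using Nat.strong_induction_on with
    | _ d ih =>
      intro i hi
      match d, ih, hi with
      | 0, _, _ => exact crossCount_eq_zero_of_card_le_one _ _ _ _ (hle _)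
      | 1, _, hi =>
        rw [h.cross_left (by omega)]
        exact crossCount_eq_zero_of_card_le_one _ _ _ _ (hleH _)
      | d + 2, ih, hi =>
        have h1 := h.cross_diag (i := i) (j := i + d + 1) (by omega) (by omega)
        rw [show i + (d + 2) = i + d + 1 + 1 by omega, ← h1]
        have h2 := ih d (by omega) (i + 1) (by omega)
        rwa [show i + 1 + d = i + d + 1 by omega] at h2
  refine ⟨?_, hinj, ?_⟩
  · have himg : A.image gG = (range (L + 1)).image fun i : ℕ => gH v - i * a := by
      ext t
      simp only [mem_image, mem_range]
      constructor
      · rintro ⟨x, hx, rfl⟩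
        obtain ⟨i, hi, e⟩ := hidx x hx
        exact ⟨i, by omega, e.symm⟩
      · rintro ⟨i, hi, rfl⟩
        have h1 := hlev (gH v - i * a)
        rw [downChain_sub] at h1
        have h2 : downChain a (gG v) (gH v - i * a + a) = 0 := by
          refine downChain_of_lt ha ?_
          have : (i : ℤ) ≤ L := by exact_mod_cast Nat.le_of_lt_succ hi
          nlinarith
        obtain ⟨x, hx⟩ := card_pos.1 (show 0 < #{u ∈ A | gG u = gH v - i * a} by omega)
        exact ⟨x, (mem_filter.1 hx).1, (mem_filter.1 hx).2⟩
    rw [← card_image_of_injOn (s := A) (f := gG) (fun x hx y hy => hinj x hx y hy), himg,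
      card_image_of_injective, card_range]
    intro i j hij
    have : (i : ℤ) = j := mul_right_cancel₀ ha.ne' (by linear_combination -hij)
    exact_mod_cast this
  · intro x hx y hy hxy
    by_contra hadj
    obtain ⟨i, hi, ei⟩ := hidx x hx
    obtain ⟨j, hj, ej⟩ := hidx y hy
    rcases le_total i j with hij | hij
    · obtain ⟨d, rfl⟩ := Nat.exists_eq_add_of_le hij
      have := hcross d i hj
      rw [crossCount, card_eq_zero, filter_eq_empty_iff] at this
      exact this (x := (x, y)) (mem_product.2 ⟨hx, hy⟩) ⟨⟨hxy, hadj⟩, ei, ej⟩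
    · obtain ⟨d, rfl⟩ := Nat.exists_eq_add_of_le hij
      have := hcross d j hi
      rw [crossCount, card_eq_zero, filter_eq_empty_iff] at this
      exact this (x := (y, x)) (mem_product.2 ⟨hy, hx⟩)
        ⟨⟨hxy.symm, fun e => hadj e.symm⟩, ej, ei⟩

end IsShifted
end ShiftMain

/-! ### The number of larger cliques -/

section Main

/-- Three distinct entries of row r sum to at most 2^r: take C(r,t), an entry equal to r and an
entry equal to 1. -/
theorem choose_add_lt_two_pow {r : ℕ} (hr : 3 ≤ r) (t : ℕ) : r.choose t + r < 2 ^ r := by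
  have hsum := Nat.sum_range_choose r
  have three : ∀ i j k : ℕ, i ≤ r → j ≤ r → k ≤ r → i ≠ j → i ≠ k → j ≠ k →
      r.choose i + (r.choose j + r.choose k) ≤ 2 ^ r := by
    intro i j k hi hj hk hij hik hjk
    rw [← hsum, ← sum_pair (f := r.choose) hjk,
      ← sum_insert (a := i) (f := r.choose) (by simp [hij, hik])]
    refine sum_le_sum_of_subset fun x hx => ?_
    simp only [mem_insert, mem_singleton] at hx
    rw [mem_range]
    omega
  have h0 := Nat.choose_zero_right r
  have h1 := Nat.choose_one_right r
  have hrr := Nat.choose_self r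
  by_cases htr : r < t
  · rw [Nat.choose_eq_zero_of_lt htr, zero_add]
    exact Nat.lt_two_pow_self
  by_cases ht1 : t = 1
  · subst ht1
    have h2 := three 1 (r - 1) 0 (by omega) (by omega) (by omega) (by omega) (by omega) (by omega)
    have h3 := Nat.choose_symm (n := r) (k := 1) (by omega)
    omega
  by_cases ht0 : t = 0
  · subst ht0
    have h2 := three 0 1 r (by omega) (by omega) (by omega) (by omega) (by omega) (by omega)
    omega
  · have h2 := three t 1 0 (by omega) (by omega) (by omega) ht1 ht0 (by omega)
    omega

variable {V : Type*} [Fintype V]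

theorem swap_adj_iff {V : Type*} (G : SimpleGraph V) {y y' : V}
    (h : ∀ z, z ≠ y → z ≠ y' → (G.Adj y z ↔ G.Adj y' z)) (a b : V) :
    G.Adj a b ↔ G.Adj (Equiv.swap y y' a) (Equiv.swap y y' b) := by
  have h' : ∀ z, z ≠ y → z ≠ y' → (G.Adj z y ↔ G.Adj z y') := fun z h1 h2 => by
    rw [G.adj_comm z y, G.adj_comm z y']; exact h z h1 h2
  simp only [Equiv.swap_apply_def]
  by_cases ha : a = y
  · subst ha
    by_cases hb : b = a
    · subst hb; simp
    · by_cases hb' : b = y'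
      · subst hb'; simp [hb, G.adj_comm]
      · simp [hb, hb', h b hb hb']
  · by_cases ha' : a = y'
    · subst ha'
      by_cases hb : b = y
      · subst hb; simp [ha, G.adj_comm]
      · by_cases hb' : b = a
        · subst hb'; simp [ha]
        · simp [ha, hb, hb', h b hb hb']
    · by_cases hb : b = y
      · subst hb; simp [ha, ha', h' a ha ha']
      · by_cases hb' : b = y'
        · subst hb'; simp [ha, ha', hb, h' a ha ha']
        · simp [ha, ha', hb, hb']

/-- The `q`-cliques avoiding `u` and its non-neighbours extend to `(q+1)`-cliques through `u`. -/
theorem cliqueDeg_succ_add (G : SimpleGraph V) (q : ℕ) (u : V) :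
    cliqueDeg G (q + 1) u + cliqueDeg G q u +
      #{s : Finset V | G.IsNClique q s ∧ u ∉ s ∧ ∃ p ∈ s, ¬ G.Adj u p} = numCliques G q := by
  rw [numCliques_eq_add G q u, cliqueDeg_succ,
    ← card_filter_add_card_filter_not
      (s := ({s : Finset V | G.IsNClique q s ∧ u ∉ s} : Finset (Finset V)))
      (p := fun s => ∀ y ∈ s, G.Adj u y), filter_filter, filter_filter]
  have e1 : #{s : Finset V | (G.IsNClique q s ∧ u ∉ s) ∧ ∀ y ∈ s, G.Adj u y} =
      #{s : Finset V | G.IsNClique q s ∧ ∀ y ∈ s, G.Adj u y} := by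
    congr 1
    ext s
    simp only [mem_filter, mem_univ, true_and]
    exact ⟨fun h => ⟨h.1.1, h.2⟩, fun h => ⟨⟨h.1, fun hu => (h.2 u hu).ne rfl⟩, h.2⟩⟩
  have e2 : #{s : Finset V | (G.IsNClique q s ∧ u ∉ s) ∧ ¬ ∀ y ∈ s, G.Adj u y} =
      #{s : Finset V | G.IsNClique q s ∧ u ∉ s ∧ ∃ p ∈ s, ¬ G.Adj u p} := by
    congr 1
    ext s
    simp only [mem_filter, mem_univ, true_and]
    push Not
    tauto
  rw [e1, e2]
  omega

theorem cliqueDeg_succ_add_of_universal (G : SimpleGraph V) (q : ℕ) (u : V)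
    (hu : ∀ y, y ≠ u → G.Adj u y) :
    cliqueDeg G (q + 1) u + cliqueDeg G q u = numCliques G q := by
  rw [← cliqueDeg_succ_add G q u, eq_comm, Nat.add_eq_left, card_eq_zero, filter_eq_empty_iff]
  rintro s - ⟨-, h2, p, hp, h3⟩
  exact h3 (hu p fun e => h2 (e ▸ hp))

/-- The q-cliques avoiding u that do not extend by u are exactly those through p. Hence for K = 1
the statistic of a non-neighbour of v is fixed by q-clique data, which G and H share. -/
theorem cliqueDeg_succ_add_of_unique (G : SimpleGraph V) (q : ℕ) (u p : V) (hpu : p ≠ u)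
    (hp : ¬ G.Adj u p) (hu : ∀ y, y ≠ u → y ≠ p → G.Adj u y) :
    cliqueDeg G (q + 1) u + cliqueDeg G q u + cliqueDeg G q p = numCliques G q := by
  rw [← cliqueDeg_succ_add G q u]
  congr 1
  rw [cliqueDeg]
  congr 1
  ext s
  simp only [mem_filter, mem_univ, true_and]
  refine and_congr_right fun hs => ⟨fun hps => ⟨fun hus => ?_, p, hps, hp⟩, ?_⟩
  · exact hp (hs.isClique hus hps hpu.symm)
  · rintro ⟨h1, y, hy, h2⟩
    by_cases hyp : y = p
    · exact hyp ▸ hy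
    · exact absurd (hu y (fun e => h1 (e ▸ hy)) hyp) h2

variable {G H : SimpleGraph V} {v : V}

theorem HypomorphicExcept.cliqueDeg_eq (h : HypomorphicExcept G H v) {r : ℕ}
    (hr : numCliques G r = numCliques H r) (x : V) : cliqueDeg G r x = cliqueDeg H r x := by
  by_cases hx : x = v
  · subst hx
    have := h.cliqueDeg_exception r
    rw [hr, sub_self, mul_zero, add_zero] at this
    exact_mod_cast this.symm
  · have := h.cliqueDeg_eq_add r hx
    rw [hr, sub_self, add_zero] at this
    exact_mod_cast this

/-- Such a vertex still has degree Δ in the card at x. Were its image adjacent to x, that image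
would have degree Δ + 1 in H. -/
theorem IsCardIso.mem_nonNbrsIn {x : V} {σ : Equiv.Perm V} (hσ : IsCardIso G H x σ) {Δ : ℕ}
    {A : Finset V} (hA : ∀ u, u ∈ A ↔ vdeg G u = Δ) (hdeg : ∀ u, vdeg G u = vdeg H u)
    (hmax : ∀ u, vdeg G u ≤ Δ) {u : V} (hu : u ∈ nonNbrsIn G A x) : σ u ∈ nonNbrsIn H A x := by
  simp only [nonNbrsIn, mem_filter, hA] at hu ⊢
  have h1 := hσ.vdeg_eq hu.2.1
  rw [if_neg hu.2.2, hu.1] at h1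
  have h2 := hmax (σ u)
  rw [hdeg] at h2 ⊢
  have h3 : ¬ H.Adj x (σ u) := by
    intro hadj
    rw [if_pos hadj] at h1
    omega
  rw [if_neg h3] at h1
  exact ⟨by omega, fun e => hu.2.1 (σ.injective (e.trans hσ.1.symm)), h3⟩

theorem IsCardIso.mem_nonNbrsIn_iff {x : V} {σ : Equiv.Perm V} (hσ : IsCardIso G H x σ) {Δ : ℕ}
    {A : Finset V} (hA : ∀ u, u ∈ A ↔ vdeg G u = Δ) (hdeg : ∀ u, vdeg G u = vdeg H u)
    (hmax : ∀ u, vdeg G u ≤ Δ) (u : V) : u ∈ nonNbrsIn G A x ↔ σ u ∈ nonNbrsIn H A x := by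
  refine ⟨hσ.mem_nonNbrsIn hA hdeg hmax, fun hu => ?_⟩
  have := hσ.symm.mem_nonNbrsIn (fun u => (hA u).trans (by rw [hdeg])) (fun u => (hdeg u).symm)
    (fun u => hdeg u ▸ hmax u) hu
  simpa using this

/-- If all non-neighbours of a vertex `x` of maximum degree have maximum degree, then the card
at `x` determines the graph. -/
theorem IsCardIso.adj_iff_of_card {V : Type*} {G H : SimpleGraph V} {x : V} {σ : Equiv.Perm V} (hσ : IsCardIso G H x σ)
    {A : Finset V} (hmem : ∀ u, u ∈ nonNbrsIn G A x ↔ σ u ∈ nonNbrsIn H A x)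
    (hG : ∀ u, u ≠ x → ¬ G.Adj x u → u ∈ A) (hH : ∀ u, u ≠ x → ¬ H.Adj x u → u ∈ A) (y z : V) :
    G.Adj y z ↔ H.Adj (σ y) (σ z) := by
  have hx : ∀ u, G.Adj x u ↔ H.Adj x (σ u) := by
    intro u
    by_cases hu : u = x
    · subst hu; simp [hσ.1]
    have hσu : σ u ≠ x := fun e => hu (σ.injective (e.trans hσ.1.symm))
    have := hmem u
    simp only [nonNbrsIn, mem_filter] at this
    constructor
    · intro hadj
      by_contra hn
      exact (this.2 ⟨hH _ hσu hn, hσu, hn⟩).2.2 hadj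
    · intro hadj
      by_contra hn
      exact (this.1 ⟨hG _ hu hn, hu, hn⟩).2.2 hadj
  by_cases hy : y = x
  · subst hy; rw [hσ.1]; exact hx z
  by_cases hz : z = x
  · subst hz; rw [hσ.1, G.adj_comm, H.adj_comm]; exact hx y
  exact hσ.2 y z hy hz

/-- A clique of vertices of equal degree that are distinguished by their clique degrees is small
compared with the number of remaining vertices. -/
theorem card_le_choose (G : SimpleGraph V) (A : Finset V) (Δ : ℕ)
    (hA : ∀ x ∈ A, vdeg G x = Δ) (hcl : ∀ x ∈ A, ∀ y ∈ A, y ≠ x → G.Adj x y)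
    (hinj : ∀ x ∈ A, ∀ y ∈ A, (∀ r, cliqueDeg G r x = cliqueDeg G r y) → x = y) :
    ∃ t, #A ≤ (#(Aᶜ)).choose t := by
  -- The common number of neighbours outside the clique A of its vertices.
  refine ⟨Δ + 1 - #A, ?_⟩
  rw [← card_powersetCard]
  refine card_le_card_of_injOn (fun x => {y ∈ Aᶜ | G.Adj x y}) ?_ ?_
  · intro x hx
    rw [mem_coe] at hx
    rw [mem_coe, mem_powersetCard]
    refine ⟨filter_subset _ _, ?_⟩
    have h1 : vdeg G x = #(A.erase x) + #{y ∈ Aᶜ | G.Adj x y} := by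
      rw [vdeg, ← card_filter_add_card_filter_not (p := fun y => y ∈ A), filter_filter,
        filter_filter]
      congr 2
      · ext y
        simp only [mem_filter, mem_univ, true_and, mem_erase]
        exact ⟨fun h => ⟨h.1.ne', h.2⟩, fun h => ⟨hcl x hx y h.2 h.1, h.2⟩⟩
      · ext y
        simp [and_comm]
    rw [hA x hx, card_erase_of_mem hx] at h1
    have : 0 < #A := card_pos.2 ⟨x, hx⟩
    beta_reduce
    omega
  · intro x hx y hy hxy
    rw [mem_coe] at hx hy
    refine hinj x hx y hy fun r => ?_
    -- Vertices of A with equal outside neighbourhoods are exchanged by an automorphism of G.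
    have := cliqueDeg_eq_of_iso (G := G) (H := G) (Equiv.swap x y) r x (swap_adj_iff G ?_)
    · rwa [Equiv.swap_apply_left] at this
    · intro z hzx hzy
      by_cases hz : z ∈ A
      · exact iff_of_true (hcl x hx z hz hzx) (hcl y hy z hz hzy)
      · have := Finset.ext_iff.1 hxy z
        simpa [hz] using this

theorem HypomorphicExcept.not_numCliques_lt (h : HypomorphicExcept G H v) {q : ℕ} (hq : 2 ≤ q)
    (hn : 2 ^ (q + 1) ≤ Fintype.card V) (h2 : numCliques G 2 = numCliques H 2)
    (hqc : numCliques G q = numCliques H q) : ¬ numCliques H (q + 1) < numCliques G (q + 1) := by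
  intro hlt
  have hdeg : ∀ u, vdeg G u = vdeg H u := fun u => by
    rw [← cliqueDeg_two, ← cliqueDeg_two]; exact h.cliqueDeg_eq h2 u
  have hcq := h.cliqueDeg_eq hqc
  obtain ⟨m, -, hm⟩ := exists_max_image univ (vdeg G) ⟨v, mem_univ v⟩
  obtain ⟨Δ, hΔ⟩ : ∃ Δ, Δ = vdeg G m := ⟨_, rfl⟩
  have hmax : ∀ u, vdeg G u ≤ Δ := fun u => hΔ ▸ hm u (mem_univ u)
  obtain ⟨A, hA⟩ : ∃ A : Finset V, ∀ u, u ∈ A ↔ vdeg G u = Δ :=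
    ⟨({u | vdeg G u = Δ} : Finset V), by simp⟩
  have hAne : A.Nonempty := ⟨m, (hA m).2 hΔ.symm⟩
  obtain ⟨K, hK⟩ : ∃ K, K + Δ + 1 = Fintype.card V := by
    have := vdeg_lt G m
    exact ⟨Fintype.card V - 1 - Δ, by omega⟩
  have hpow : q + 1 + 1 < 2 ^ (q + 1) := by
    have := choose_add_lt_two_pow (show 3 ≤ q + 1 by omega) 0
    rw [Nat.choose_zero_right] at this
    omega
  -- L is the coefficient n-1-(q+1) of `cliqueDeg_exception`.
  obtain ⟨L, hL⟩ : ∃ L, L + 1 + (q + 1) = Fintype.card V :=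
    ⟨Fintype.card V - 1 - (q + 1), by omega⟩
  have hLpos : 0 < L := by omega
  set a : ℤ := (numCliques G (q + 1) : ℤ) - numCliques H (q + 1) with ha
  -- The q-clique term is equal in G and H, so it does not affect the shift; it makes the statistic
  -- computable for vertices with at most one non-neighbour.
  let gG : V → ℤ := fun u => (cliqueDeg G (q + 1) u : ℤ) + cliqueDeg G q u
  let gH : V → ℤ := fun u => (cliqueDeg H (q + 1) u : ℤ) + cliqueDeg H q u
  have hKG : ∀ x ∈ A, #{u | u ≠ x ∧ ¬ G.Adj x u} = K := fun x hx => by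
    have := card_nonNbr G x
    rw [(hA x).1 hx] at this
    omega
  have hKH : ∀ x ∈ A, #{u | u ≠ x ∧ ¬ H.Adj x u} = K := fun x hx => by
    have := card_nonNbr H x
    rw [← hdeg, (hA x).1 hx] at this
    omega
  have hS : IsShifted G H v A K L a gG gH := by
    refine ⟨by omega, fun x hx => ?_, ?_, hKG, hKH, fun x hx p _ => ?_⟩
    · have := h.cliqueDeg_eq_add (q + 1) hx
      have := hcq x
      simp only [gG, gH]
      omega
    · have h1 := h.cliqueDeg_exception (q + 1)
      rw [← ha, ← hL] at h1
      simp only [gG, gH, h1, hcq v]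
      push_cast
      ring
    · obtain ⟨σ, hσ⟩ := h x hx
      refine Finset.card_equiv σ fun u => ?_
      rw [mem_filter, mem_filter, ← hσ.mem_nonNbrsIn_iff hA hdeg hmax u]
      refine and_congr_right fun hu => ?_
      have hσu := (hσ.mem_nonNbrsIn_iff hA hdeg hmax u).1 hu
      simp only [nonNbrsIn, mem_filter] at hu hσu
      have : gG u = gH (σ u) := by
        simp only [gG, gH]
        rw [hσ.cliqueDeg_eq (q + 1) hu.2.1 hu.2.2 hσu.2.2,
          hσ.cliqueDeg_eq q hu.2.1 hu.2.2 hσu.2.2]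
      rw [this]
  have hsub : ∀ (F : SimpleGraph V) (x : V),
      nonNbrsIn F A x ⊆ ({u | u ≠ x ∧ ¬ F.Adj x u} : Finset V) := fun F x u hu => by
    simp only [nonNbrsIn, mem_filter, mem_univ, true_and] at hu ⊢
    exact hu.2
  -- If all K non-neighbours of x had maximum degree, the card at x would determine its
  -- neighbourhood and G ≅ H would follow.
  have hnK : ∀ x ∈ A, x ≠ v → #(nonNbrsIn G A x) < K := by
    intro x hx hxv
    by_contra hge
    obtain ⟨σ, hσ⟩ := h x hxv
    have hmem := hσ.mem_nonNbrsIn_iff hA hdeg hmax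
    have hcard : #(nonNbrsIn G A x) = #(nonNbrsIn H A x) := Finset.card_equiv σ hmem
    have all : ∀ F : SimpleGraph V, #{u | u ≠ x ∧ ¬ F.Adj x u} ≤ #(nonNbrsIn F A x) →
        ∀ u, u ≠ x → ¬ F.Adj x u → u ∈ A := by
      intro F hF u hu hadj
      have h1 : u ∈ ({u | u ≠ x ∧ ¬ F.Adj x u} : Finset V) := by simp [hu, hadj]
      rw [← eq_of_subset_of_card_le (hsub F x) hF] at h1
      exact (mem_filter.1 h1).1
    have := numCliques_eq_of_iso σ (q + 1) (hσ.adj_iff_of_card hmem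
      (all G (by rw [hKG x hx]; omega)) (all H (by rw [hKH x hx]; omega)))
    omega
  have hK0 : 0 < K := by
    rw [Nat.pos_iff_ne_zero]
    rintro rfl
    obtain ⟨x, hx⟩ := hAne
    have univl : ∀ F : SimpleGraph V, #{u | u ≠ x ∧ ¬ F.Adj x u} = 0 →
        ∀ y, y ≠ x → F.Adj x y := by
      intro F hF y hy
      rw [card_eq_zero, filter_eq_empty_iff] at hF
      by_contra hn
      exact hF (mem_univ y) ⟨hy, hn⟩
    have e1 := cliqueDeg_succ_add_of_universal G q x (univl G (hKG x hx))
    have e2 := cliqueDeg_succ_add_of_universal H q x (univl H (hKH x hx))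
    have e3 : gG x = gH x := by simp only [gG, gH]; omega
    have hpos := hS.pos
    by_cases hxv : x = v
    · subst hxv
      have h1 := hS.exception
      have : 0 < (L : ℤ) * a := by positivity
      omega
    · have := hS.shift x hxv
      omega
  by_cases hv : v ∈ A
  · obtain ⟨hcard, hinj, hcl⟩ := hS.isClique hv hK0 hnK
    obtain ⟨t, ht⟩ := card_le_choose G A Δ (fun x hx => (hA x).1 hx) hcl
      (fun x hx y hy hxy => hinj x hx y hy (by simp only [gG, hxy]))
    rw [card_compl, hcard, show Fintype.card V - (L + 1) = q + 1 by omega] at ht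
    have := choose_add_lt_two_pow (show 3 ≤ q + 1 by omega) t
    omega
  · refine hS.false_of_notMem hv hAne hK0 fun hK1 => ?_
    subst hK1
    have uniq : ∀ F : SimpleGraph V, (∀ x ∈ A, #{u | u ≠ x ∧ ¬ F.Adj x u} = 1) →
        ∀ u ∈ nonNbrsIn F A v, cliqueDeg F (q + 1) u + cliqueDeg F q u + cliqueDeg F q v =
          numCliques F q := by
      intro F hF u hu
      simp only [nonNbrsIn, mem_filter] at hu
      have hvu : ¬ F.Adj u v := fun e => hu.2.2 e.symm
      refine cliqueDeg_succ_add_of_unique F q u v hu.2.1.symm hvu fun y hy hyv => ?_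
      by_contra hn
      exact hyv (card_le_one.1 (hF u hu.1).le y (by simp [hy, hn]) v (by simp [hu.2.1.symm, hvu]))
    refine ⟨(numCliques G q : ℤ) - cliqueDeg G q v, fun u hu => ?_, fun u hu => ?_⟩
    · have := uniq G hKG u hu
      simp only [gG]
      omega
    · have := uniq H hKH u hu
      rw [hqc, hcq v]
      simp only [gH]
      omega

theorem HypomorphicExcept.numCliques_eq (h : HypomorphicExcept G H v)
    (hn : 7 ≤ Fintype.card V) (r : ℕ) (hr : 2 ^ r ≤ Fintype.card V) :
    numCliques G r = numCliques H r := by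
  induction r with
  | zero =>
    simp only [numCliques]
    congr 1
    ext s
    simp
  | succ q ih =>
    have hq' : 2 ^ q ≤ 2 ^ (q + 1) := Nat.pow_le_pow_right (by norm_num) (by omega)
    have ihq := ih (hq'.trans hr)
    rcases (by omega : q = 0 ∨ q = 1 ∨ 2 ≤ q) with rfl | rfl | hq
    · simp only [numCliques]
      congr 1
      ext s
      simp [SimpleGraph.isNClique_iff, SimpleGraph.isClique_iff, card_eq_one]
      rintro x rfl
      simp
    · exact h.edges_eq hn
    · have h2 := h.edges_eq hn
      exact le_antisymm (not_lt.1 (h.not_numCliques_lt hq hr h2 ihq))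
        (not_lt.1 (h.symm.not_numCliques_lt hq hr h2.symm ihq.symm))

end Main

end CliqueReconstruction

theorem mainTheorem3 (n r : ℕ) (hn : 7 ≤ n) (hr : (r : ℝ) ≤ Real.logb 2 (n : ℝ)) :
    ReconstructibleFromCards.{u} n (n - 1) (fun _ G => cliqueCount G r) := by
  have hpow : 2 ^ r ≤ n := by
    rw [Real.le_logb_iff_rpow_le one_lt_two (by positivity), Real.rpow_natCast] at hr
    exact_mod_cast hr
  refine CliqueReconstruction.reconstructible_of_hypomorphicExcept n r (by omega) ?_
  intro V _ G H v hV h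
  rw [CliqueReconstruction.cliqueCount_eq_numCliques,
    CliqueReconstruction.cliqueCount_eq_numCliques]
  exact h.numCliques_eq (hV ▸ hn) r (hV ▸ hpow)
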